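/- Let $R(\lambda)\in\mathbb{C}(\lambda)^{m\times m}$ be a strictly proper rational matrix (in every entry the degree of the numerator is smaller than the degree of the denominator), with Laurent expansion $R(\lambda)=R_{-1}\lambda^{-1}+R_{-2}\lambda^{-2}+R_{-3}\lambda^{-3}+\cdots$ around infinity. For $k\ge 1$ let $H=[R_{-(i+j-1)}]_{i,j=1}^k$ and $H_\sigma=[R_{-(i+j)}]_{i,j=1}^k$ be the associated $k\times k$ block Hankel matrices, and let $S:=\operatorname{diag}(-I_m,(-1)^2I_m,\ldots,(-1)^kI_m)$. Let $\delta$ be the total polar degree of the finite poles of $R(\lambda)$, i.e., the sum of the degrees of the denominators in the Smith--McMillan form of $R(\lambda)$. Definitions. A rational (or polynomial) matrix $G(\lambda)$ is called Hermitian, skew-Hermitian, para-Hermitian or para-skew-Hermitian if, respectively, $[G(\lambda)]^*=G(\overline\lambda)$, $[G(\lambda)]^*=-G(\overline\lambda)$, $[G(\lambda)]^*=G(-\overline\lambda)$ or $[G(\lambda)]^*=-G(-\overline\lambda)$, for all $\lambda\in\mathbb{C}$ at which both sides are defined. A block partitioned pencil $$L(\lambda)=\begin{bmatrix}\lambda A_1-A_0&-\lambda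 B_1+B_0\\ \lambda C_1-C_0&\lambda D_1-D_0\end{bmatrix}=:\begin{bmatrix}A(\lambda)&-B(\lambda)\\ C(\lambda)&D(\lambda)\end{bmatrix}$$ is a strongly minimal linearization of $R(\lambda)$ if $\det A(\lambda)\not\equiv 0$, $R(\lambda)=D(\lambda)+C(\lambda)A(\lambda)^{-1}B(\lambda)$, the matrices $\begin{bmatrix}A(\lambda_0)&-B(\lambda_0)\end{bmatrix}$ and $\begin{bmatrix}A(\lambda_0)\\ C(\lambda_0)\end{bmatrix}$ have, respectively, full row and full column rank for every $\lambda_0\in\mathbb{C}$, and so do $\begin{bmatrix}A_1&-B_1\end{bmatrix}$ and $\begin{bmatrix}A_1\\ C_1\end{bmatrix}$. Theorem. For all sufficiently large $k$ one has $\operatorname{rank}H=\delta$. Let $k\ge1$ be such that $\operatorname{rank} H=\delta$, put $r_f:=\operatorname{rank}H$, and let $U=[U_1\ U_2]$ and $V=[V_1\ V_2]$ be unitary matrices, with $U_1,V_1$ of size $km\times r_f$, such that $$U^*HV=\begin{bmatrix}\widehat H&0\\0&0\end{bmatrix},\qquad \widehat H=U_1^*HV_1\in\mathbb{C}^{r_f\times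 r_f}\ \text{invertible}.$$ Suppose that $U=V$ if $R(\lambda)$ is Hermitian or skew-Hermitian (cases 1 and 2), and that $U=SV$ if $R(\lambda)$ is para-Hermitian or para-skew-Hermitian (cases 3 and 4). Let $V_{11}\in\mathbb{C}^{m\times r_f}$ consist of the first $m$ rows of $V_1$. 1. If $R(\lambda)$ is Hermitian, then $\widehat H^*=\widehat H$, $H_\sigma^*=H_\sigma$, and $\begin{bmatrix}V_1^*H_\sigma V_1-\lambda\widehat H&\widehat HV_{11}^*\\ V_{11}\widehat H&0\end{bmatrix}$ is a Hermitian strongly minimal linearization of $R(\lambda)$. 2. If $R(\lambda)$ is skew-Hermitian, then $\widehat H^*=-\widehat H$, $H_\sigma^*=-H_\sigma$, and $\begin{bmatrix}V_1^*H_\sigma V_1-\lambda\widehat H&\widehat HV_{11}^*\\ V_{11}\widehat H&0\end{bmatrix}$ is a skew-Hermitian strongly minimal linearization of $R(\lambda)$. 3. If $R(\lambda)$ is para-Hermitian, then $\widehat H^*=-\widehat H$, $(SH_\sigma)^*=SH_\sigma$, and $\begin{bmatrix}V_1^*SH_\sigma V_1-\lambda\widehat H&\widehat HV_{11}^*\\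 -V_{11}\widehat H&0\end{bmatrix}$ is a para-Hermitian strongly minimal linearization of $R(\lambda)$. 4. If $R(\lambda)$ is para-skew-Hermitian, then $\widehat H^*=\widehat H$, $(SH_\sigma)^*=-SH_\sigma$, and $\begin{bmatrix}V_1^*SH_\sigma V_1-\lambda\widehat H&\widehat HV_{11}^*\\ -V_{11}\widehat H&0\end{bmatrix}$ is a para-skew-Hermitian strongly minimal linearization of $R(\lambda)$. -/

import Mathlib

open scoped Polynomial Matrix

noncomputable section

namespace RationalLinearization

/-! ### Rational matrices -/

/-- A rational matrix is strictly proper if in each entry the degree of the numerator is smaller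
than the degree of the denominator (the zero polynomial has degree `⊥`). -/
def IsStrictlyProper {m n : Type*} (R : Matrix m n (RatFunc ℂ)) : Prop :=
  ∀ i j, (R i j).num.degree < (R i j).denom.degree

/-- The matrix of rational functions attached to a polynomial matrix. -/
def polyToRat {m n : Type*} (P : Matrix m n ℂ[X]) : Matrix m n (RatFunc ℂ) :=
  P.map (algebraMap ℂ[X] (RatFunc ℂ))

/-- The Laurent expansion of a rational function `r(λ)` at infinity, as a formal Laurent series in
`t = 1/λ`: one substitutes `λ = t⁻¹` in the numerator and in the denominator. -/
def laurentAtInfinity (r : RatFunc ℂ) : LaurentSeries ℂ :=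
  RatFunc.eval (HahnSeries.C : ℂ →+* LaurentSeries ℂ) (HahnSeries.single (-1 : ℤ) (1 : ℂ)) r

/-- The matrix `R_{-i}`, that is, the coefficient of `λ^{-i}` in the Laurent expansion of `R(λ)` at
infinity. -/
def laurentCoeff {m n : Type*} (R : Matrix m n (RatFunc ℂ)) (i : ℕ) : Matrix m n ℂ :=
  R.map fun r => (laurentAtInfinity r).coeff (i : ℤ)

/-- `diag(ε₀/ψ₀, ε₁/ψ₁, …)` is the Smith-McMillan form of the square rational matrix `R`: it is
obtained from `R` by multiplication with unimodular polynomial matrices, the fractions are reduced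
and normalized, each `ε i` divides the next one and each `ψ i` is divisible by the next one.
Beyond the normal rank of `R` one has `ε i = 0`, `ψ i = 1`. -/
structure IsSmithMcMillanForm {m : ℕ} (R : Matrix (Fin m) (Fin m) (RatFunc ℂ))
    (ε ψ : Fin m → ℂ[X]) : Prop where
  num_monic : ∀ i, (ε i).Monic ∨ ε i = 0
  den_monic : ∀ i, (ψ i).Monic
  coprime : ∀ i, IsCoprime (ε i) (ψ i)
  num_dvd : ∀ i j, i ≤ j → ε i ∣ ε j
  den_dvd : ∀ i j, i ≤ j → ψ j ∣ ψ i
  equivalent : ∃ P Q : Matrix (Fin m) (Fin m) ℂ[X], IsUnit P ∧ IsUnit Q ∧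
    polyToRat P * R * polyToRat Q =
      Matrix.diagonal fun i =>
        algebraMap ℂ[X] (RatFunc ℂ) (ε i) / algebraMap ℂ[X] (RatFunc ℂ) (ψ i)

/-- The total polar degree of the finite poles of `R`: the sum of the degrees of the denominators
in the Smith-McMillan form of `R`. The form is unique, so the set below has one element. -/
def finitePolarDegree {m : ℕ} (R : Matrix (Fin m) (Fin m) (RatFunc ℂ)) : ℕ :=
  sInf {d | ∃ ε ψ : Fin m → ℂ[X], IsSmithMcMillanForm R ε ψ ∧ d = ∑ i, (ψ i).natDegree}

/-! ### Block Hankel matrices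

A `k × k` block matrix with `m × m` blocks is indexed by `Fin k × Fin m`
(block index, index inside the block). Block indices start at `0`. -/

/-- The block Hankel matrix `H` with blocks `R_{-1}, …, R_{-2k+1}`. -/
def blockHankel {m : ℕ} (R : Matrix (Fin m) (Fin m) (RatFunc ℂ)) (k : ℕ) :
    Matrix (Fin k × Fin m) (Fin k × Fin m) ℂ :=
  Matrix.of fun a b => laurentCoeff R (a.1.val + b.1.val + 1) a.2 b.2

/-- The shifted block Hankel matrix `H_σ` with blocks `R_{-2}, …, R_{-2k}`. -/
def shiftedBlockHankel {m : ℕ} (R : Matrix (Fin m) (Fin m) (RatFunc ℂ)) (k : ℕ) :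
    Matrix (Fin k × Fin m) (Fin k × Fin m) ℂ :=
  Matrix.of fun a b => laurentCoeff R (a.1.val + b.1.val + 2) a.2 b.2

/-- The scaling matrix `S = diag(-I_m, (-1)^2 I_m, …, (-1)^k I_m)`. -/
def scaling (k m : ℕ) : Matrix (Fin k × Fin m) (Fin k × Fin m) ℂ :=
  Matrix.diagonal fun a => (-1 : ℂ) ^ (a.1.val + 1)

/-- A matrix (with possibly different index types for rows and columns) is unitary. -/
def IsUnitary {a b : Type*} [Fintype a] [Fintype b] [DecidableEq a] [DecidableEq b]
    (U : Matrix a b ℂ) : Prop :=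
  Uᴴ * U = 1 ∧ U * Uᴴ = 1

/-- `Ĥ = U₁ᴴ H V₁`, where `U₁`, `V₁` consist of the first `r` columns of `U`, `V`. -/
def compressedHankel {m r s : ℕ} (R : Matrix (Fin m) (Fin m) (RatFunc ℂ)) (k : ℕ)
    (U V : Matrix (Fin k × Fin m) (Fin r ⊕ Fin s) ℂ) : Matrix (Fin r) (Fin r) ℂ :=
  U.toCols₁ᴴ * blockHankel R k * V.toCols₁

/-- `U = [U₁ U₂]` and `V = [V₁ V₂]` are unitary and `Uᴴ H V = [Ĥ 0; 0 0]` with `Ĥ` of size `r × r`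
and invertible. In particular `r` is the rank of `H`, and `r + s = k m`. -/
structure IsHankelCompression {m r s : ℕ} (R : Matrix (Fin m) (Fin m) (RatFunc ℂ)) (k : ℕ)
    (U V : Matrix (Fin k × Fin m) (Fin r ⊕ Fin s) ℂ) : Prop where
  unitary_left : IsUnitary U
  unitary_right : IsUnitary V
  compress : Uᴴ * blockHankel R k * V = Matrix.fromBlocks (compressedHankel R k U V) 0 0 0
  invertible : IsUnit (compressedHankel R k U V)

/-- `V₁₁`: the first `m` rows (that is, the first block row) of `V₁`. -/
def firstBlock {k m r s : ℕ} [NeZero k] (V : Matrix (Fin k × Fin m) (Fin r ⊕ Fin s) ℂ) :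
    Matrix (Fin m) (Fin r) ℂ :=
  Matrix.of fun i j => V.toCols₁ (0, i) j

/-- Constant matrices as polynomial matrices. -/
def constPoly {m n : Type*} (M : Matrix m n ℂ) : Matrix m n ℂ[X] :=
  M.map Polynomial.C

/-- The pencil `[M - λ Ĥ, N; K, 0]`. -/
def systemPencil {m r : ℕ} (M Ĥ : Matrix (Fin r) (Fin r) ℂ) (N : Matrix (Fin r) (Fin m) ℂ)
    (K : Matrix (Fin m) (Fin r) ℂ) : Matrix (Fin r ⊕ Fin m) (Fin r ⊕ Fin m) ℂ[X] :=
  Matrix.fromBlocks (constPoly M - (Polynomial.X : ℂ[X]) • constPoly Ĥ) (constPoly N)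
    (constPoly K) 0

/-! ### Strongly minimal linearizations -/

/-- The value of a polynomial matrix at a point. -/
def evalPoly {m n : Type*} (P : Matrix m n ℂ[X]) (z : ℂ) : Matrix m n ℂ :=
  P.map (Polynomial.eval z)

/-- The matrix of coefficients of `λ` of a pencil. -/
def leadingPart {m n : Type*} (P : Matrix m n ℂ[X]) : Matrix m n ℂ :=
  P.map fun q => q.coeff 1

/-- The block partitioned matrix `L(λ) = [A(λ), -B(λ); C(λ), D(λ)]`, with `A(λ)` of size `p × p`,
is a strongly minimal linearization of the rational matrix `R(λ)`: it is a pencil with `A(λ)`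
regular and transfer function matrix `D(λ) + C(λ) A(λ)⁻¹ B(λ) = R(λ)`, and
`[A(λ), -B(λ)]` and `[A(λ); C(λ)]` have full row rank and full column rank, respectively,
at every finite point and at infinity. -/
structure IsStronglyMinimalLinearization {p m n : ℕ}
    (L : Matrix (Fin p ⊕ Fin m) (Fin p ⊕ Fin n) ℂ[X]) (R : Matrix (Fin m) (Fin n) (RatFunc ℂ)) :
    Prop where
  pencil : ∀ i j, (L i j).natDegree ≤ 1
  regular : L.toBlocks₁₁.det ≠ 0
  row_rank : ∀ z : ℂ, (evalPoly L.toRows₁ z).rank = p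
  col_rank : ∀ z : ℂ, (evalPoly L.toCols₁ z).rank = p
  row_rank_infinity : (leadingPart L.toRows₁).rank = p
  col_rank_infinity : (leadingPart L.toCols₁).rank = p
  transfer : polyToRat L.toBlocks₂₂ +
    polyToRat L.toBlocks₂₁ * (polyToRat L.toBlocks₁₁)⁻¹ * polyToRat (-L.toBlocks₁₂) = R

/-! ### Self-conjugate structures -/

/-- The four self-conjugate structures. -/
inductive SelfConjugacy
  | hermitian
  | skewHermitian
  | paraHermitian
  | paraSkewHermitian

/-- The sign in `[P(λ)]^* = ± P(·)`. -/
def SelfConjugacy.sign : SelfConjugacy → ℂ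
  | hermitian => 1
  | skewHermitian => -1
  | paraHermitian => 1
  | paraSkewHermitian => -1

/-- The reflected point: `conj λ` in the Hermitian and skew-Hermitian cases, `-conj λ` in the
para-Hermitian and para-skew-Hermitian cases. -/
def SelfConjugacy.reflect : SelfConjugacy → ℂ → ℂ
  | hermitian, z => star z
  | skewHermitian, z => star z
  | paraHermitian, z => -star z
  | paraSkewHermitian, z => -star z

/-- A polynomial matrix has the given self-conjugate structure:
`[P(λ)]^* = ± P(± conj λ)` for all `λ`. -/
def SelfConjugacy.HoldsPoly (κ : SelfConjugacy) {m : Type*} (P : Matrix m m ℂ[X]) : Prop :=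
  ∀ z : ℂ, (evalPoly P z)ᴴ = κ.sign • evalPoly P (κ.reflect z)

/-- The point `z` is not a pole of any entry of `R`. -/
def IsRegularPoint {m n : Type*} (R : Matrix m n (RatFunc ℂ)) (z : ℂ) : Prop :=
  ∀ i j, (R i j).denom.eval z ≠ 0

/-- The value of a rational matrix at a point that is not a pole. -/
def evalRat {m n : Type*} (R : Matrix m n (RatFunc ℂ)) (z : ℂ) : Matrix m n ℂ :=
  R.map (RatFunc.eval (RingHom.id ℂ) z)

/-- A rational matrix has the given self-conjugate structure:
`[R(λ)]^* = ± R(± conj λ)` at all points where both sides are defined. -/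
def SelfConjugacy.HoldsRat (κ : SelfConjugacy) {m : Type*} (R : Matrix m m (RatFunc ℂ)) : Prop :=
  ∀ z : ℂ, IsRegularPoint R z → IsRegularPoint R (κ.reflect z) →
    (evalRat R z)ᴴ = κ.sign • evalRat R (κ.reflect z)

end RationalLinearization

end

/-! Let the Hankel operator send a polynomial vector `u` to the principal part at infinity of `R u`.
Its image, the Hankel space, is the column space of the infinite block Hankel matrix. If `P R Q =
diag(ε i / ψ i)` is the Smith-McMillan form, then `R Q v` is polynomial exactly when every `ψ i`
divides `v i`. The Hankel space is therefore isomorphic to the sum of the quotients `ℂ[X]/(ψ i)`, of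
dimension `δ` (`hankelSpace_equiv`, `finrank_hankelSpace`).

The matrix `H` consists of the first `k` block columns, truncated to `k` block rows. Hence `rank H =
δ` forces those columns to span the Hankel space and truncation to be injective on it; finite
dimension gives both for large `k`. Then `x ↦ U₁ᴴ x` is a coordinate system on the Hankel space. In
it the backward shift, which is multiplication by `λ`, has the matrix `F = U₁ᴴ H_σ V₁ Ĥ⁻¹`
(`stateCoordinates_shift`). With `U₁₁` the first block row of `U₁`, this gives `R_{-(i+1)} = U₁₁ Fⁱ
Ĥ V₁₁ᴴ` (`laurentCoeff_eq`), a controllable and observable realization. Multiplying its state pencil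
by `Ĥ` yields a strongly minimal linearization without any symmetry assumption.

For the structures, let `σ` be the sign of the identity and `τ = ±1` the sign in the reflected point
`τ conj λ`. Comparing Laurent coefficients gives `R_{-i}ᴴ = σ τⁱ R_{-i}`. With `T = diag(τ I, τ² I,
…)`, the matrices `T H` and `T H_σ` are selfadjoint up to the signs `σ τ` and `σ`. The choice `U = T
V` makes both compressions congruences by `V₁`, so the symmetry passes to the pencil
(`HoldsRat.structured_linearization`). -/

noncomputable section

namespace RationalLinearization

/-! ### Smith normal form over a Euclidean domain -/

section Smith

variable {A : Type*} [CommRing A]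

/-- The block diagonal matrix `diag(a, M)`. -/
def bordered {n : ℕ} (a : A) (M : Matrix (Fin n) (Fin n) A) :
    Matrix (Fin (n + 1)) (Fin (n + 1)) A :=
  Matrix.of fun i j => Fin.cases (Fin.cases a (fun _ => 0) j)
    (fun i' => Fin.cases 0 (fun j' => M i' j') j) i

theorem bordered_mul {n : ℕ} (a b : A) (M N : Matrix (Fin n) (Fin n) A) :
    bordered a M * bordered b N = bordered (a * b) (M * N) := by
  ext i j
  refine Fin.cases ?_ (fun i => ?_) i <;> refine Fin.cases ?_ (fun j => ?_) j <;>
    simp [bordered, Matrix.mul_apply, Fin.sum_univ_succ]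

theorem bordered_diagonal {n : ℕ} (a : A) (e : Fin n → A) :
    bordered a (Matrix.diagonal e) = Matrix.diagonal (Fin.cons a e : Fin (n + 1) → A) := by
  ext i j
  refine Fin.cases ?_ (fun i => ?_) i <;> refine Fin.cases ?_ (fun j => ?_) j <;>
    simp [bordered, Matrix.diagonal_apply, Fin.succ_ne_zero, (Fin.succ_ne_zero _).symm]

theorem bordered_one {n : ℕ} : bordered (1 : A) (1 : Matrix (Fin n) (Fin n) A) = 1 := by
  rw [← Matrix.diagonal_one, bordered_diagonal, ← Matrix.diagonal_one]
  congr 1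
  ext i
  refine Fin.cases ?_ (fun i => ?_) i <;> simp

theorem isUnit_bordered {n : ℕ} {P : Matrix (Fin n) (Fin n) A} (hP : IsUnit P) :
    IsUnit (bordered 1 P) := by
  obtain ⟨u, rfl⟩ := hP
  exact ⟨⟨bordered 1 ↑u, bordered 1 ↑u⁻¹, by simp [bordered_mul, bordered_one],
    by simp [bordered_mul, bordered_one]⟩, rfl⟩

/-- Two square matrices are equivalent if they differ by invertible factors on both sides. -/
def IsEquivalent {n : Type*} [Fintype n] [DecidableEq n] (M N : Matrix n n A) : Prop :=
  ∃ P Q : Matrix n n A, IsUnit P ∧ IsUnit Q ∧ P * M * Q = N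

theorem IsEquivalent.refl {n : Type*} [Fintype n] [DecidableEq n] (M : Matrix n n A) :
    IsEquivalent M M := ⟨1, 1, isUnit_one, isUnit_one, by simp⟩

theorem IsEquivalent.mul_left {n : Type*} [Fintype n] [DecidableEq n] {M N P : Matrix n n A}
    (h : IsEquivalent M N) (hP : IsUnit P) : IsEquivalent M (P * N) := by
  obtain ⟨P', Q', hP', hQ', rfl⟩ := h
  exact ⟨P * P', Q', hP.mul hP', hQ', by simp [Matrix.mul_assoc]⟩

theorem IsEquivalent.mul_right {n : Type*} [Fintype n] [DecidableEq n] {M N Q : Matrix n n A}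
    (h : IsEquivalent M N) (hQ : IsUnit Q) : IsEquivalent M (N * Q) := by
  obtain ⟨P', Q', hP', hQ', rfl⟩ := h
  exact ⟨P', Q' * Q, hP', hQ'.mul hQ, by simp [Matrix.mul_assoc]⟩

theorem isUnit_transvection {n : Type*} [Fintype n] [DecidableEq n] {i j : n} (h : i ≠ j) (c : A) :
    IsUnit (Matrix.transvection i j c) := by
  rw [Matrix.isUnit_iff_isUnit_det, Matrix.det_transvection_of_ne i j h]
  exact isUnit_one

theorem isUnit_swap {n : Type*} [Fintype n] [DecidableEq n] (i j : n) :
    IsUnit (Matrix.swap A i j) :=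
  ⟨⟨_, _, Matrix.swap_mul_self i j, Matrix.swap_mul_self i j⟩, rfl⟩

/-- The rank-one term squares to zero, so changing its sign inverts the matrix. One such factor
clears a whole row or column. -/
theorem isUnit_one_add_vecMulVec {n : Type*} [Fintype n] [DecidableEq n] {v w : n → A}
    (h : w ⬝ᵥ v = 0) : IsUnit (1 + Matrix.vecMulVec v w) := by
  have h0 : Matrix.vecMulVec v w * Matrix.vecMulVec v w = 0 := by
    rw [Matrix.vecMulVec_mul_vecMulVec, h]; simp
  refine ⟨⟨1 + Matrix.vecMulVec v w, 1 - Matrix.vecMulVec v w, ?_, ?_⟩, rfl⟩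
  · rw [add_mul, mul_sub, mul_sub, h0]; simp
  · rw [sub_mul, mul_add, mul_add, h0]; simp

end Smith

/-- The Smith normal form of a square matrix over a Euclidean domain. -/
theorem exists_smithForm {A : Type*} [EuclideanDomain A] :
    ∀ {n : ℕ} (M : Matrix (Fin n) (Fin n) A), ∃ e : Fin n → A, (∀ i j, i ≤ j → e i ∣ e j) ∧
      IsEquivalent M (Matrix.diagonal e) := by
  classical
  intro n
  induction n with
  | zero => exact fun M => ⟨0, fun i => i.elim0, by
      convert IsEquivalent.refl M using 1; exact Subsingleton.elim _ _⟩
  | succ n ih =>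
    intro M
    by_cases hM : M = 0
    · refine ⟨0, fun i j _ => dvd_rfl, ?_⟩
      rw [hM, show Matrix.diagonal (0 : Fin (n + 1) → A) = 0 from Matrix.diagonal_zero]
      exact IsEquivalent.refl _
    -- A Euclidean-minimal nonzero entry over the whole equivalence class replaces an explicit
    -- elimination algorithm: a remainder modulo `d` that occurs as an entry must vanish.
    let S : Set A := {x | x ≠ 0 ∧ ∃ N, IsEquivalent M N ∧ ∃ i j, N i j = x}
    have hS : S.Nonempty := by
      by_contra h
      apply hM
      ext i j
      by_contra hij
      exact h ⟨M i j, hij, M, IsEquivalent.refl M, i, j, rfl⟩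
    obtain ⟨d, ⟨hd0, N₀, hN₀, i₀, j₀, hd⟩, hmin⟩ :=
      (EuclideanDomain.r_wellFounded (R := A)).has_min S hS
    have dvd_of_mod {N : Matrix (Fin (n + 1)) (Fin (n + 1)) A} (hN : IsEquivalent M N) (i j)
        (a : A) (h : N i j = a % d) : d ∣ a := by
      rw [← EuclideanDomain.mod_eq_zero]
      by_contra hne
      exact hmin (a % d) ⟨hne, N, hN, i, j, h⟩ (EuclideanDomain.mod_lt a hd0)
    have hmod (a : A) : a + -(a / d) * d = a % d := by
      rw [EuclideanDomain.mod_eq_sub_mul_div]; ring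
    have row {N : Matrix (Fin (n + 1)) (Fin (n + 1)) A} (hN : IsEquivalent M N) (h00 : N 0 0 = d)
        (j) (hj : j ≠ 0) : d ∣ N 0 j := by
      refine dvd_of_mod (hN.mul_right (isUnit_transvection hj.symm (-(N 0 j / d)))) 0 j _ ?_
      rw [Matrix.mul_transvection_apply_same, h00, hmod]
    have col {N : Matrix (Fin (n + 1)) (Fin (n + 1)) A} (hN : IsEquivalent M N) (h00 : N 0 0 = d)
        (i) (hi : i ≠ 0) : d ∣ N i 0 := by
      refine dvd_of_mod (hN.mul_left (isUnit_transvection hi (-(N i 0 / d)))) i 0 _ ?_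
      rw [Matrix.transvection_mul_apply_same, h00, hmod]
    -- move the minimal entry to the corner
    obtain ⟨N₁, hN₁, hd₁⟩ : ∃ N, IsEquivalent M N ∧ N 0 0 = d := by
      refine ⟨_, (hN₀.mul_left (isUnit_swap 0 i₀)).mul_right (isUnit_swap 0 j₀), ?_⟩
      rw [Matrix.mul_swap_apply_left, Matrix.swap_mul_apply_left, hd]
    -- clear the first row
    obtain ⟨N₂, hN₂, hd₂, hr₂⟩ : ∃ N, IsEquivalent M N ∧ N 0 0 = d ∧ ∀ j, j ≠ 0 → N 0 j = 0 := by
      choose! q hq using row hN₁ hd₁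
      refine ⟨_, hN₁.mul_right (isUnit_one_add_vecMulVec (v := Pi.single 0 1)
        (w := fun j => if j = 0 then 0 else -q j) (by simp)), ?_, fun j hj => ?_⟩
      · simp [Matrix.mul_add, Matrix.mul_vecMulVec, Matrix.vecMulVec_apply, hd₁]
      · simp [Matrix.mul_add, Matrix.mul_vecMulVec, Matrix.vecMulVec_apply, hd₁, hj, hq j hj]
    obtain ⟨N₃, hN₃, hd₃, hr₃, hc₃⟩ : ∃ N, IsEquivalent M N ∧ N 0 0 = d ∧
        (∀ j, j ≠ 0 → N 0 j = 0) ∧ ∀ i, i ≠ 0 → N i 0 = 0 := by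
      choose! q hq using col hN₂ hd₂
      refine ⟨_, hN₂.mul_left (isUnit_one_add_vecMulVec (w := Pi.single 0 1)
        (v := fun j => if j = 0 then 0 else -q j) (by simp)), ?_, fun j hj => ?_, fun i hi => ?_⟩
      · simp [Matrix.add_mul, Matrix.vecMulVec_mul, Matrix.vecMulVec_apply, hd₂]
      · simp [Matrix.add_mul, Matrix.vecMulVec_mul, Matrix.vecMulVec_apply, hr₂ j hj]
      · simp [Matrix.add_mul, Matrix.vecMulVec_mul, Matrix.vecMulVec_apply, hd₂, hi, hq i hi,
          mul_comm]
    -- Adding row `i.succ` to row `0` keeps the corner `d`, since column `0` is already cleared, and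
    -- moves the entry into the first row, where `row` applies.
    have hdvd (i j : Fin n) : d ∣ N₃ i.succ j.succ := by
      have hi := Fin.succ_ne_zero i
      have hj := Fin.succ_ne_zero j
      have := row (hN₃.mul_left (isUnit_transvection hi.symm 1))
        (by rw [Matrix.transvection_mul_apply_same, hd₃, hc₃ _ hi]; simp) j.succ hj
      rwa [Matrix.transvection_mul_apply_same, hr₃ _ hj, zero_add, one_mul] at this
    obtain ⟨e, he, P, Q, hP, hQ, hPQ⟩ := ih (N₃.submatrix Fin.succ Fin.succ)
    have hN₃' : N₃ = bordered d (N₃.submatrix Fin.succ Fin.succ) := by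
      ext i j
      refine Fin.cases ?_ (fun i => ?_) i <;> refine Fin.cases ?_ (fun j => ?_) j <;>
        simp [bordered, hd₃, hr₃ _ (Fin.succ_ne_zero _), hc₃ _ (Fin.succ_ne_zero _)]
    have hde (i) : d ∣ e i := by
      have h : e i = (P * N₃.submatrix Fin.succ Fin.succ * Q) i i := by rw [hPQ]; simp
      rw [h, Matrix.mul_apply]
      refine Finset.dvd_sum fun k _ => Dvd.dvd.mul_right ?_ _
      rw [Matrix.mul_apply]
      exact Finset.dvd_sum fun l _ => Dvd.dvd.mul_left (hdvd _ _) _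
    refine ⟨Fin.cons d e, fun i j => ?_, ?_⟩
    · refine Fin.cases ?_ (fun i => ?_) i <;> refine Fin.cases ?_ (fun j => ?_) j
      · simp
      · simp [hde]
      · simp
      · simpa using he i j
    · have := (hN₃.mul_left (isUnit_bordered hP)).mul_right (isUnit_bordered hQ)
      rwa [hN₃', bordered_mul, bordered_mul, hPQ, one_mul, mul_one, bordered_diagonal] at this

/-- Every square rational matrix has a Smith-McMillan form. -/
theorem exists_isSmithMcMillanForm {m : ℕ} (R : Matrix (Fin m) (Fin m) (RatFunc ℂ)) :
    ∃ ε ψ : Fin m → ℂ[X], IsSmithMcMillanForm R ε ψ := by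
  obtain ⟨d, hd⟩ := IsLocalization.exist_integer_multiples_of_finite (nonZeroDivisors ℂ[X])
    (fun ij : Fin m × Fin m => R ij.1 ij.2)
  choose N hN using hd
  have hd0 : (d : ℂ[X]) ≠ 0 := nonZeroDivisors.coe_ne_zero d
  have hd0' : algebraMap ℂ[X] (RatFunc ℂ) d ≠ 0 := RatFunc.algebraMap_ne_zero hd0
  obtain ⟨e, he, P, Q, hP, hQ, hPQ⟩ :=
    exists_smithForm (Matrix.of fun i j => N (i, j) : Matrix (Fin m) (Fin m) ℂ[X])
  -- The Smith form of the numerators over the common denominator `d` gives unreduced fractions; `ε`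
  -- and `ψ` come from the reduced forms of the `x i`.
  set x : Fin m → RatFunc ℂ := fun i => algebraMap ℂ[X] (RatFunc ℂ) (e i) / algebraMap _ _ (d : ℂ[X])
  have hx : polyToRat P * R * polyToRat Q = Matrix.diagonal x := by
    have h1 : polyToRat (Matrix.of fun i j => N (i, j)) =
        algebraMap ℂ[X] (RatFunc ℂ) d • R := by
      ext i j
      simpa [polyToRat, Algebra.smul_def] using hN (i, j)
    have h2 := congrArg polyToRat hPQ
    simp only [polyToRat, Matrix.map_mul] at h1 h2
    rw [h1, Matrix.mul_smul, Matrix.smul_mul] at h2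
    have h3 := congrArg (fun M => (algebraMap ℂ[X] (RatFunc ℂ) d)⁻¹ • M) h2
    simp only [smul_smul, inv_mul_cancel₀ hd0', one_smul] at h3
    rw [polyToRat, polyToRat, h3]
    ext i j
    rcases eq_or_ne i j with rfl | hij
    · simp [x, div_eq_inv_mul]
    · simp [hij]
  -- One identity serves both divisibility chains: coprimality of numerator and denominator is used
  -- at `i` for the numerators and at `j` for the denominators.
  have hcross (i j) (hij : i ≤ j) : ∃ q, (x i).num * q * (x j).denom = (x j).num * (x i).denom := by
    obtain ⟨q, hq⟩ := he i j hij
    refine ⟨q, ?_⟩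
    apply RatFunc.algebraMap_injective ℂ
    have hi := RatFunc.algebraMap_ne_zero (x i).denom_ne_zero
    have hj := RatFunc.algebraMap_ne_zero (x j).denom_ne_zero
    have key : x i * algebraMap _ _ q = x j := by
      simp only [x, hq, map_mul]; ring
    rw [← (x i).num_div_denom, ← (x j).num_div_denom, div_mul_eq_mul_div,
      div_eq_div_iff hi hj] at key
    simpa using key
  have hu (p : ℂ[X]) : IsUnit ((normUnit p : ℂ[X]ˣ) : ℂ[X]) := Units.isUnit _
  -- `RatFunc.denom` is monic but `RatFunc.num` need not be; the normalizing units are absorbed into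
  -- the right factor.
  refine ⟨fun i => normalize (x i).num, fun i => (x i).denom, ?_, ?_, ?_, ?_, ?_, ?_⟩
  · intro i
    by_cases h : (x i).num = 0
    · right; simp [h]
    · left; exact Polynomial.monic_normalize h
  · exact fun i => (x i).monic_denom
  · intro i
    exact (isCoprime_mul_unit_right_left (hu _) _ _).2 (x i).isCoprime_num_denom
  · intro i j hij
    obtain ⟨q, hq⟩ := hcross i j hij
    rw [normalize_dvd_iff, dvd_normalize_iff]
    refine (x i).isCoprime_num_denom.dvd_of_dvd_mul_right ⟨q * (x j).denom, ?_⟩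
    rw [← hq, mul_assoc]
  · intro i j hij
    obtain ⟨q, hq⟩ := hcross i j hij
    refine (x j).isCoprime_num_denom.symm.dvd_of_dvd_mul_left (Dvd.intro_left _ hq)
  · refine ⟨P, Q * Matrix.diagonal fun i => ((normUnit (x i).num : ℂ[X]ˣ) : ℂ[X]), hP, ?_, ?_⟩
    · refine hQ.mul ?_
      rw [Matrix.isUnit_iff_isUnit_det, Matrix.det_diagonal]
      exact (Units.isUnit (∏ i, normUnit (x i).num)).imp (by simp)
    · have : polyToRat (Q * Matrix.diagonal fun i => ((normUnit (x i).num : ℂ[X]ˣ) : ℂ[X])) =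
          polyToRat Q * polyToRat (Matrix.diagonal fun i => ((normUnit (x i).num : ℂ[X]ˣ) : ℂ[X])) :=
        Matrix.map_mul
      rw [this, ← mul_assoc, hx, polyToRat, Matrix.diagonal_map (map_zero _),
        Matrix.diagonal_mul_diagonal]
      congr 1
      ext i
      simp only [normalize_apply, map_mul]
      rw [mul_div_right_comm, RatFunc.num_div_denom]

/-! ### Laurent expansions at infinity -/

/-- The substitution `λ = t⁻¹` in polynomials. -/
def polyLaurent : ℂ[X] →+* LaurentSeries ℂ :=
  Polynomial.eval₂RingHom (HahnSeries.C : ℂ →+* LaurentSeries ℂ) (HahnSeries.single (-1 : ℤ) (1 : ℂ))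

theorem polyLaurent_C (a : ℂ) : polyLaurent (Polynomial.C a) = HahnSeries.C a := by
  simp [polyLaurent]

theorem polyLaurent_X : polyLaurent Polynomial.X = HahnSeries.single (-1 : ℤ) (1 : ℂ) := by
  simp [polyLaurent]

theorem polyLaurent_monomial (n : ℕ) (a : ℂ) :
    polyLaurent (Polynomial.monomial n a) = HahnSeries.single (-(n : ℤ)) a := by
  simp [polyLaurent, Polynomial.eval₂_monomial, HahnSeries.single_pow, HahnSeries.C_apply,
    HahnSeries.single_mul_single]

theorem polyLaurent_coeff_neg (p : ℂ[X]) (n : ℕ) : (polyLaurent p).coeff (-(n : ℤ)) = p.coeff n := by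
  induction p using Polynomial.induction_on' with
  | add p q hp hq => simp [hp, hq]
  | monomial k a =>
    rw [polyLaurent_monomial, Polynomial.coeff_monomial, HahnSeries.coeff_single]
    simp [eq_comm]

theorem polyLaurent_coeff_pos (p : ℂ[X]) {i : ℤ} (hi : 0 < i) : (polyLaurent p).coeff i = 0 := by
  induction p using Polynomial.induction_on' with
  | add p q hp hq => simp [hp, hq]
  | monomial k a =>
    rw [polyLaurent_monomial, HahnSeries.coeff_single_of_ne]
    lia

theorem polyLaurent_coeff_of_lt (p : ℂ[X]) {i : ℤ} (hi : i < -(p.natDegree : ℤ)) :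
    (polyLaurent p).coeff i = 0 := by
  obtain ⟨n, rfl⟩ : ∃ n : ℕ, i = -(n : ℤ) := ⟨i.natAbs, by lia⟩
  rw [polyLaurent_coeff_neg]
  exact Polynomial.coeff_eq_zero_of_natDegree_lt (by lia)

theorem polyLaurent_injective : Function.Injective polyLaurent := by
  intro p q h
  ext n
  rw [← polyLaurent_coeff_neg, h, polyLaurent_coeff_neg]

theorem polyLaurent_order {p : ℂ[X]} (hp : p ≠ 0) :
    (polyLaurent p).order = -(p.natDegree : ℤ) := by
  have hp' : polyLaurent p ≠ 0 := (map_ne_zero_iff _ polyLaurent_injective).2 hp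
  apply le_antisymm
  · apply HahnSeries.order_le_of_coeff_ne_zero
    rw [polyLaurent_coeff_neg]
    simpa using hp
  · by_contra! h
    exact hp' (HahnSeries.coeff_order_eq_zero.1 (polyLaurent_coeff_of_lt p h))

theorem nonZeroDivisors_le_comap_polyLaurent :
    nonZeroDivisors ℂ[X] ≤ (nonZeroDivisors (LaurentSeries ℂ)).comap polyLaurent :=
  nonZeroDivisors_le_comap_nonZeroDivisors_of_injective _ polyLaurent_injective

/-- The Laurent expansion at infinity as a ring homomorphism. -/
def laurentHom : RatFunc ℂ →+* LaurentSeries ℂ :=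
  RatFunc.liftRingHom polyLaurent nonZeroDivisors_le_comap_polyLaurent

/-- Lets coefficients of `laurentAtInfinity`, defined through the bare function `RatFunc.eval`, be
computed with a ring homomorphism. -/
theorem laurentHom_apply (r : RatFunc ℂ) : laurentHom r = laurentAtInfinity r := by
  rw [laurentHom, RatFunc.liftRingHom_apply]
  rfl

theorem laurentHom_algebraMap (p : ℂ[X]) :
    laurentHom (algebraMap ℂ[X] (RatFunc ℂ) p) = polyLaurent p :=
  RatFunc.liftRingHom_algebraMap _ _ _

/-- Orders add under multiplication and a polynomial has order minus its degree, so the quotient has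
order `deg q - deg p > 0`. -/
theorem laurentHom_div_coeff_of_nonpos {p q : ℂ[X]} (h : p.degree < q.degree) {i : ℤ}
    (hi : i ≤ 0) :
    (laurentHom (algebraMap ℂ[X] (RatFunc ℂ) p / algebraMap _ _ q)).coeff i = 0 := by
  by_cases hp : p = 0
  · simp [hp]
  have hq : q ≠ 0 := by rintro rfl; simp at h
  have hp' := RatFunc.algebraMap_ne_zero hp
  have hq' := RatFunc.algebraMap_ne_zero hq
  set r := algebraMap ℂ[X] (RatFunc ℂ) p / algebraMap _ _ q with hr
  have hmul : laurentHom r * polyLaurent q = polyLaurent p := by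
    rw [← laurentHom_algebraMap, ← laurentHom_algebraMap, ← map_mul, hr, div_mul_cancel₀ _ hq']
  have hord := congrArg HahnSeries.order hmul
  rw [HahnSeries.order_mul ((map_ne_zero _).2 (div_ne_zero hp' hq'))
    ((map_ne_zero_iff _ polyLaurent_injective).2 hq), polyLaurent_order hq,
    polyLaurent_order hp] at hord
  have hdeg := (Polynomial.natDegree_lt_natDegree_iff hp).2 h
  exact HahnSeries.coeff_eq_zero_of_lt_order (by lia)

theorem laurentHom_coeff_of_nonpos {r : RatFunc ℂ} (hr : r.num.degree < r.denom.degree) {i : ℤ}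
    (hi : i ≤ 0) : (laurentHom r).coeff i = 0 := by
  rw [← r.num_div_denom]
  exact laurentHom_div_coeff_of_nonpos hr hi

theorem laurentHom_X_mul_coeff (r : RatFunc ℂ) (i : ℤ) :
    (laurentHom (algebraMap ℂ[X] (RatFunc ℂ) Polynomial.X * r)).coeff i =
      (laurentHom r).coeff (i + 1) := by
  rw [map_mul, laurentHom_algebraMap, polyLaurent_X, HahnSeries.coeff_single_mul]
  simp

theorem laurentHom_monomial_mul_coeff (n : ℕ) (a : ℂ) (r : RatFunc ℂ) (i : ℤ) :
    (laurentHom (algebraMap ℂ[X] (RatFunc ℂ) (Polynomial.monomial n a) * r)).coeff i =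
      a * (laurentHom r).coeff (i + n) := by
  rw [map_mul, laurentHom_algebraMap, polyLaurent_monomial, HahnSeries.coeff_single_mul]
  simp

/-- A rational function is a polynomial as soon as its Laurent expansion has no principal part. -/
theorem mem_range_algebraMap_iff (r : RatFunc ℂ) :
    r ∈ Set.range (algebraMap ℂ[X] (RatFunc ℂ)) ↔ ∀ i : ℕ, (laurentHom r).coeff (i + 1) = 0 := by
  constructor
  · rintro ⟨p, rfl⟩ i
    rw [laurentHom_algebraMap]
    exact polyLaurent_coeff_pos p (by lia)
  · intro h
    have hq := RatFunc.algebraMap_ne_zero r.denom_ne_zero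
    -- Division by the denominator leaves a strictly proper remainder. Its nonpositive coefficients
    -- vanish by degree and the positive ones by hypothesis, so it is zero by injectivity of
    -- `laurentHom`.
    set s : RatFunc ℂ := algebraMap ℂ[X] _ (r.num %ₘ r.denom) / algebraMap _ _ r.denom with hs
    have hr : r = algebraMap ℂ[X] _ (r.num /ₘ r.denom) + s := by
      have h1 := congrArg (algebraMap ℂ[X] (RatFunc ℂ))
        (Polynomial.modByMonic_add_div r.num r.denom)
      rw [map_add, map_mul] at h1
      nth_rewrite 1 [← r.num_div_denom]
      rw [hs, ← h1, add_div, mul_div_cancel_left₀ _ hq, add_comm]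
    have hs0 : s = 0 := by
      rw [← map_eq_zero laurentHom]
      ext i
      rw [HahnSeries.coeff_zero]
      rcases le_or_gt i 0 with hi | hi
      · exact laurentHom_div_coeff_of_nonpos
          (Polynomial.degree_modByMonic_lt _ r.monic_denom) hi
      · obtain ⟨n, rfl⟩ : ∃ n : ℕ, i = n + 1 := ⟨(i - 1).toNat, by lia⟩
        have := h n
        rwa [hr, map_add, laurentHom_algebraMap, HahnSeries.coeff_add,
          polyLaurent_coeff_pos _ hi, zero_add] at this
    exact ⟨_, by rw [hr, hs0, add_zero]⟩

section HankelSpace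

/-! ### The space spanned by the columns of the infinite block Hankel matrix -/

variable {m : ℕ}

/-- The infinite block Hankel operator: it maps a polynomial vector `u` to the principal part at
infinity of `R u`. -/
def hankelOperator (R : Matrix (Fin m) (Fin m) (RatFunc ℂ)) :
    (Fin m → ℂ[X]) →ₗ[ℂ] (ℕ → Fin m → ℂ) where
  toFun u i a :=
    (laurentHom ((R *ᵥ fun b => algebraMap ℂ[X] (RatFunc ℂ) (u b)) a)).coeff ((i : ℤ) + 1)
  map_add' u v := by
    ext i a
    simp [Matrix.mulVec, dotProduct, mul_add, Finset.sum_add_distrib]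
  map_smul' c u := by
    ext i a
    have h : (R *ᵥ fun b => algebraMap ℂ[X] (RatFunc ℂ) ((c • u) b)) a =
        algebraMap ℂ[X] (RatFunc ℂ) (Polynomial.monomial 0 c) *
          (R *ᵥ fun b => algebraMap ℂ[X] (RatFunc ℂ) (u b)) a := by
      simp only [Matrix.mulVec, dotProduct, Finset.mul_sum]
      refine Finset.sum_congr rfl fun b _ => ?_
      rw [Pi.smul_apply, Polynomial.smul_eq_C_mul, map_mul, Polynomial.monomial_zero_left]
      ring
    rw [h, laurentHom_monomial_mul_coeff]
    simp

theorem hankelOperator_eq_zero_iff (R : Matrix (Fin m) (Fin m) (RatFunc ℂ)) (u : Fin m → ℂ[X]) :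
    hankelOperator R u = 0 ↔ ∃ v : Fin m → ℂ[X],
      (R *ᵥ fun b => algebraMap ℂ[X] (RatFunc ℂ) (u b)) = fun a => algebraMap _ _ (v a) := by
  have h1 : hankelOperator R u = 0 ↔ ∀ a, (R *ᵥ fun b => algebraMap ℂ[X] (RatFunc ℂ) (u b)) a ∈
      Set.range (algebraMap ℂ[X] (RatFunc ℂ)) := by
    simp_rw [mem_range_algebraMap_iff]
    exact ⟨fun h a i => congrFun (congrFun h i) a, fun h => funext fun i => funext fun a => h a i⟩
  rw [h1]
  constructor
  · intro h
    choose v hv using h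
    exact ⟨v, funext fun a => (hv a).symm⟩
  · rintro ⟨v, hv⟩ a
    exact ⟨v a, (congrFun hv a).symm⟩

/-- The Hankel space of `R`. -/
def hankelSpace (R : Matrix (Fin m) (Fin m) (RatFunc ℂ)) : Submodule ℂ (ℕ → Fin m → ℂ) :=
  LinearMap.range (hankelOperator R)

theorem polyToRat_mulVec (P : Matrix (Fin m) (Fin m) ℂ[X]) (v : Fin m → ℂ[X]) :
    (polyToRat P *ᵥ fun b => algebraMap ℂ[X] (RatFunc ℂ) (v b)) =
      fun a => algebraMap ℂ[X] (RatFunc ℂ) ((P *ᵥ v) a) := by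
  ext a
  simp [polyToRat, Matrix.mulVec, dotProduct]

/-- The unimodular factor `P` does not affect whether a vector is polynomial, and `P R Q v` has
entries `ε i * v i / ψ i`; coprimality decides. -/
theorem hankelOperator_mulVec_eq_zero_iff {R : Matrix (Fin m) (Fin m) (RatFunc ℂ)}
    {ε ψ : Fin m → ℂ[X]} (hψ : ∀ i, (ψ i).Monic) (hc : ∀ i, IsCoprime (ε i) (ψ i))
    {P Q : Matrix (Fin m) (Fin m) ℂ[X]} (hP : IsUnit P)
    (hPQ : polyToRat P * R * polyToRat Q = Matrix.diagonal fun i =>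
      algebraMap ℂ[X] (RatFunc ℂ) (ε i) / algebraMap ℂ[X] (RatFunc ℂ) (ψ i)) (v : Fin m → ℂ[X]) :
    hankelOperator R (Q *ᵥ v) = 0 ↔ ∀ i, ψ i ∣ v i := by
  have key : (polyToRat P *ᵥ (R *ᵥ fun b => algebraMap ℂ[X] (RatFunc ℂ) ((Q *ᵥ v) b))) = fun i =>
      algebraMap ℂ[X] (RatFunc ℂ) (ε i) / algebraMap ℂ[X] (RatFunc ℂ) (ψ i) *
        algebraMap _ _ (v i) := by
    rw [← polyToRat_mulVec, Matrix.mulVec_mulVec, Matrix.mulVec_mulVec, hPQ]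
    ext i
    rw [Matrix.mulVec_diagonal]
  have hψ' (i) := RatFunc.algebraMap_ne_zero (hψ i).ne_zero
  rw [hankelOperator_eq_zero_iff]
  constructor
  · rintro ⟨w, hw⟩ i
    rw [hw, polyToRat_mulVec] at key
    have hi := congrFun key i
    rw [div_mul_eq_mul_div, eq_div_iff (hψ' i), ← map_mul, ← map_mul] at hi
    exact (hc i).symm.dvd_of_dvd_mul_left (Dvd.intro_left _ (RatFunc.algebraMap_injective ℂ hi))
  · intro h
    choose w hw using h
    obtain ⟨P', rfl⟩ := hP
    refine ⟨(↑P'⁻¹ : Matrix (Fin m) (Fin m) ℂ[X]) *ᵥ fun i => ε i * w i, ?_⟩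
    have hinv : polyToRat (↑P'⁻¹ : Matrix (Fin m) (Fin m) ℂ[X]) *
        polyToRat (P' : Matrix (Fin m) (Fin m) ℂ[X]) = 1 := by
      rw [polyToRat, polyToRat, ← Matrix.map_mul, P'.inv_mul]
      simp
    rw [← polyToRat_mulVec _ fun i => ε i * w i, ← Matrix.one_mulVec (R *ᵥ _), ← hinv,
      ← Matrix.mulVec_mulVec, key]
    congr 1
    ext i
    rw [hw i, map_mul, map_mul, ← mul_assoc, div_mul_cancel₀ _ (hψ' i)]

/-- The Hankel space is finite-dimensional, and its dimension is the total polar degree. -/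
theorem hankelSpace_equiv {R : Matrix (Fin m) (Fin m) (RatFunc ℂ)}
    {ε ψ : Fin m → ℂ[X]} (h : IsSmithMcMillanForm R ε ψ) :
    Nonempty ((∀ i, Polynomial.degreeLT ℂ (ψ i).natDegree) ≃ₗ[ℂ] hankelSpace R) := by
  obtain ⟨P, Q, hP, hQ, hPQ⟩ := h.equivalent
  have hker := hankelOperator_mulVec_eq_zero_iff h.den_monic h.coprime hP hPQ
  let f : (∀ i, Polynomial.degreeLT ℂ (ψ i).natDegree) →ₗ[ℂ] (Fin m → ℂ[X]) :=
    LinearMap.pi fun i => (Submodule.subtype _) ∘ₗ LinearMap.proj i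
  -- Vectors of remainders modulo the `ψ i` represent each class modulo the kernel once, so `g` is a
  -- bijection onto the Hankel space.
  let g : (∀ i, Polynomial.degreeLT ℂ (ψ i).natDegree) →ₗ[ℂ] (ℕ → Fin m → ℂ) :=
    hankelOperator R ∘ₗ (Q.mulVecLin.restrictScalars ℂ) ∘ₗ f
  have hg (x) : g x = hankelOperator R (Q *ᵥ fun i => (x i : ℂ[X])) := rfl
  have hinj : Function.Injective g := by
    rw [← LinearMap.ker_eq_bot, LinearMap.ker_eq_bot']
    intro x hx
    rw [hg, hker] at hx
    ext1 i
    apply Subtype.ext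
    have hd := Polynomial.mem_degreeLT.1 (x i).2
    rw [← Polynomial.degree_eq_natDegree (h.den_monic i).ne_zero] at hd
    exact Polynomial.eq_zero_of_dvd_of_degree_lt (hx i) hd
  have hrange : LinearMap.range g = hankelSpace R := by
    apply le_antisymm
    · rintro _ ⟨x, rfl⟩
      exact ⟨_, (hg x).symm⟩
    · rintro _ ⟨u, rfl⟩
      obtain ⟨Q', rfl⟩ := hQ
      set v := (↑Q'⁻¹ : Matrix (Fin m) (Fin m) ℂ[X]) *ᵥ u with hv
      have hu : u = (Q' : Matrix (Fin m) (Fin m) ℂ[X]) *ᵥ v := by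
        rw [hv, Matrix.mulVec_mulVec, Q'.mul_inv, Matrix.one_mulVec]
      refine ⟨fun i => ⟨v i %ₘ ψ i, ?_⟩, ?_⟩
      · rw [Polynomial.mem_degreeLT, ← Polynomial.degree_eq_natDegree (h.den_monic i).ne_zero]
        exact Polynomial.degree_modByMonic_lt _ (h.den_monic i)
      · rw [hg, ← sub_eq_zero, hu, ← map_sub, ← Matrix.mulVec_sub, hker]
        intro i
        simp only [Pi.sub_apply]
        rw [Polynomial.modByMonic_eq_sub_mul_div]
        exact ⟨-(v i /ₘ ψ i), by ring⟩
  exact ⟨(LinearEquiv.ofInjective g hinj).trans (LinearEquiv.ofEq _ _ hrange)⟩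

instance (n : ℕ) : Module.Finite ℂ (Polynomial.degreeLT ℂ n) :=
  Module.Finite.equiv (Polynomial.degreeLTEquiv ℂ n).symm

theorem finrank_hankelSpace_of_isSmithMcMillanForm {R : Matrix (Fin m) (Fin m) (RatFunc ℂ)}
    {ε ψ : Fin m → ℂ[X]} (h : IsSmithMcMillanForm R ε ψ) :
    Module.finrank ℂ (hankelSpace R) = ∑ i, (ψ i).natDegree := by
  obtain ⟨e⟩ := hankelSpace_equiv h
  rw [← e.finrank_eq, Module.finrank_pi_fintype]
  refine Finset.sum_congr rfl fun i _ => ?_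
  rw [(Polynomial.degreeLTEquiv ℂ _).finrank_eq, Module.finrank_fin_fun]

instance finite_hankelSpace (R : Matrix (Fin m) (Fin m) (RatFunc ℂ)) :
    Module.Finite ℂ (hankelSpace R) := by
  obtain ⟨ε, ψ, h⟩ := exists_isSmithMcMillanForm R
  obtain ⟨e⟩ := hankelSpace_equiv h
  exact Module.Finite.equiv e

/-- Existence of a Smith-McMillan form is essential here: the infimum of an empty set would be `0`.
Being nonempty, the set contains its infimum, and any form computes the dimension. -/
theorem finrank_hankelSpace (R : Matrix (Fin m) (Fin m) (RatFunc ℂ)) :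
    Module.finrank ℂ (hankelSpace R) = finitePolarDegree R := by
  obtain ⟨ε, ψ, h⟩ := exists_isSmithMcMillanForm R
  obtain ⟨ε', ψ', h', hd⟩ :=
    Nat.sInf_mem (s := {d | ∃ ε ψ : Fin m → ℂ[X], IsSmithMcMillanForm R ε ψ ∧
      d = ∑ i, (ψ i).natDegree}) ⟨_, ε, ψ, h, rfl⟩
  rw [finitePolarDegree, hd, finrank_hankelSpace_of_isSmithMcMillanForm h']

/-! ### Finite sections -/

/-- The first `k` blocks of a sequence of vectors. -/
def truncation (m k : ℕ) : (ℕ → Fin m → ℂ) →ₗ[ℂ] (Fin k × Fin m → ℂ) where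
  toFun x c := x c.1 c.2
  map_add' _ _ := rfl
  map_smul' _ _ := rfl

/-- Polynomial vectors with given coefficients. -/
def vecPoly (m k : ℕ) : (Fin k × Fin m → ℂ) →ₗ[ℂ] (Fin m → ℂ[X]) where
  toFun x b := ∑ j : Fin k, Polynomial.monomial (j : ℕ) (x (j, b))
  map_add' x y := by ext1 b; simp [Finset.sum_add_distrib]
  map_smul' c x := by ext1 b; simp [Finset.smul_sum, Polynomial.smul_monomial]

theorem mem_range_vecPoly {k : ℕ} {u : Fin m → ℂ[X]} :
    u ∈ LinearMap.range (vecPoly m k) ↔ ∀ b, u b ∈ Polynomial.degreeLT ℂ k := by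
  constructor
  · rintro ⟨x, rfl⟩ b
    simp only [vecPoly, LinearMap.coe_mk, AddHom.coe_mk]
    refine Submodule.sum_mem (Polynomial.degreeLT ℂ k) fun j _ => ?_
    rw [Polynomial.mem_degreeLT]
    exact (Polynomial.degree_monomial_le _ _).trans_lt (by exact_mod_cast j.2)
  · intro h
    refine ⟨fun c => (u c.2).coeff c.1, ?_⟩
    ext1 b
    have hb := Polynomial.mem_degreeLT.1 (h b)
    simp only [vecPoly, LinearMap.coe_mk, AddHom.coe_mk]
    rw [Fin.sum_univ_eq_sum_range (fun j => Polynomial.monomial j ((u b).coeff j)) k]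
    by_cases h0 : u b = 0
    · simp [h0]
    · exact ((u b).as_sum_range' k ((Polynomial.natDegree_lt_iff_degree_lt h0).2 hb)).symm

/-- The first `k` block columns of the infinite block Hankel matrix. -/
def hankelColumns (R : Matrix (Fin m) (Fin m) (RatFunc ℂ)) (k : ℕ) :
    (Fin k × Fin m → ℂ) →ₗ[ℂ] (ℕ → Fin m → ℂ) :=
  hankelOperator R ∘ₗ vecPoly m k

theorem hankelColumns_apply (R : Matrix (Fin m) (Fin m) (RatFunc ℂ)) (k : ℕ)
    (x : Fin k × Fin m → ℂ) (i : ℕ) (a : Fin m) :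
    hankelColumns R k x i a = ∑ c : Fin k × Fin m, laurentCoeff R (i + c.1 + 1) a c.2 * x c := by
  simp only [hankelColumns, hankelOperator, vecPoly, LinearMap.comp_apply, LinearMap.coe_mk,
    AddHom.coe_mk, Matrix.mulVec, dotProduct, map_sum, Finset.mul_sum, HahnSeries.coeff_sum]
  rw [Fintype.sum_prod_type, Finset.sum_comm]
  refine Finset.sum_congr rfl fun j _ => Finset.sum_congr rfl fun b _ => ?_
  rw [mul_comm (R a b), laurentHom_monomial_mul_coeff, laurentCoeff, Matrix.map_apply,
    ← laurentHom_apply, mul_comm]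
  congr 2
  push_cast
  ring

theorem range_hankelColumns_le (R : Matrix (Fin m) (Fin m) (RatFunc ℂ)) (k : ℕ) :
    LinearMap.range (hankelColumns R k) ≤ hankelSpace R :=
  LinearMap.range_comp_le_range _ _

theorem blockHankel_mulVec (R : Matrix (Fin m) (Fin m) (RatFunc ℂ)) (k : ℕ)
    (x : Fin k × Fin m → ℂ) :
    blockHankel R k *ᵥ x = truncation m k (hankelColumns R k x) := by
  ext c
  simp [truncation, hankelColumns_apply, blockHankel, Matrix.mulVec, dotProduct]

/-- Moving up one block row in the infinite Hankel matrix turns `R_{-(i+j-1)}` into `R_{-(i+j)}`. -/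
theorem shiftedBlockHankel_mulVec (R : Matrix (Fin m) (Fin m) (RatFunc ℂ)) (k : ℕ)
    (x : Fin k × Fin m → ℂ) :
    shiftedBlockHankel R k *ᵥ x =
      truncation m k (fun i => hankelColumns R k x (i + 1)) := by
  ext c
  simp only [truncation, hankelColumns_apply, shiftedBlockHankel, Matrix.mulVec, dotProduct,
    LinearMap.coe_mk, AddHom.coe_mk, Matrix.of_apply]
  refine Finset.sum_congr rfl fun d _ => ?_
  congr 2
  ring_nf

theorem rank_blockHankel (R : Matrix (Fin m) (Fin m) (RatFunc ℂ)) (k : ℕ) :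
    (blockHankel R k).rank = Module.finrank ℂ
      ((LinearMap.range (hankelColumns R k)).map (truncation m k)) := by
  rw [Matrix.rank, ← LinearMap.range_comp]
  rw [show (blockHankel R k).mulVecLin = truncation m k ∘ₗ hankelColumns R k from
    LinearMap.ext (blockHankel_mulVec R k)]

/-- A finite generating set has preimages of bounded degree, and `k` block columns handle all
degrees below `k`. -/
theorem exists_range_hankelColumns_eq (R : Matrix (Fin m) (Fin m) (RatFunc ℂ)) :
    ∃ K, ∀ k, K ≤ k → LinearMap.range (hankelColumns R k) = hankelSpace R := by
  obtain ⟨t, ht⟩ := (Submodule.fg_iff_finiteDimensional _).2 (finite_hankelSpace R)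
  have hex (x : t) : ∃ K, ∀ k, K ≤ k →
      (x : ℕ → Fin m → ℂ) ∈ LinearMap.range (hankelColumns R k) := by
    have hx : (x : ℕ → Fin m → ℂ) ∈ hankelSpace R := ht ▸ Submodule.subset_span x.2
    obtain ⟨u, hu⟩ := hx
    refine ⟨Finset.univ.sup (fun b => (u b).natDegree) + 1, fun k hk => ?_⟩
    have hmem : u ∈ LinearMap.range (vecPoly m k) := by
      rw [mem_range_vecPoly]
      intro b
      have hb := Finset.le_sup (f := fun b => (u b).natDegree) (Finset.mem_univ b)
      rw [Polynomial.mem_degreeLT]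
      refine Polynomial.degree_le_natDegree.trans_lt ?_
      exact_mod_cast (by lia : (u b).natDegree < k)
    obtain ⟨y, rfl⟩ := hmem
    exact ⟨y, hu⟩
  choose K hK using hex
  refine ⟨Finset.univ.sup K, fun k hk => le_antisymm (range_hankelColumns_le R k) ?_⟩
  rw [← ht, Submodule.span_le]
  intro x hx
  exact hK ⟨x, hx⟩ k ((Finset.le_sup (Finset.mem_univ _)).trans hk)

/-- The kernels of the truncations decrease with `k`, hence stabilize in the finite-dimensional
Hankel space; a vector in the stable kernel has every block zero. -/
theorem exists_truncation_injective (R : Matrix (Fin m) (Fin m) (RatFunc ℂ)) :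
    ∃ K, ∀ k, K ≤ k → Function.Injective ((truncation m k).domRestrict (hankelSpace R)) := by
  let f : ℕ →o (Submodule ℂ (hankelSpace R))ᵒᵈ :=
    ⟨fun k => OrderDual.toDual (LinearMap.ker ((truncation m k).domRestrict (hankelSpace R))),
      fun k l hkl x hx => by
        ext c
        exact congrFun hx (⟨c.1, c.1.2.trans_le hkl⟩, c.2)⟩
  obtain ⟨K, hK⟩ := IsArtinian.monotone_stabilizes f
  refine ⟨K, fun k hk => ?_⟩
  rw [← LinearMap.ker_eq_bot, LinearMap.ker_eq_bot']
  intro x hx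
  have hmem (l) (hl : K ≤ l) :
        x ∈ LinearMap.ker ((truncation m l).domRestrict (hankelSpace R)) := by
    have h : f k = f l := (hK k hk).symm.trans (hK l hl)
    have h' := OrderDual.toDual.injective h
    rw [← h']
    exact hx
  apply Subtype.ext
  ext i a
  exact congrFun (hmem (max K (i + 1)) (le_max_left _ _)) (⟨i, by simp⟩, a)

/-! ### Finite sections of full rank -/

theorem exists_rank_blockHankel_eq (R : Matrix (Fin m) (Fin m) (RatFunc ℂ)) :
    ∃ K : ℕ, ∀ k, K ≤ k → (blockHankel R k).rank = finitePolarDegree R := by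
  obtain ⟨K₁, h₁⟩ := exists_range_hankelColumns_eq R
  obtain ⟨K₂, h₂⟩ := exists_truncation_injective R
  refine ⟨max K₁ K₂, fun k hk => ?_⟩
  rw [rank_blockHankel, h₁ k (by lia), ← finrank_hankelSpace,
    ← LinearMap.finrank_range_of_inj (h₂ k (by lia)), LinearMap.range_domRestrict]

/-- Truncation cannot raise dimension, so `δ = rank H` is at most the dimension of this range, which
lies in a space of dimension `δ`. -/
theorem range_hankelColumns_of_rank {R : Matrix (Fin m) (Fin m) (RatFunc ℂ)} {k : ℕ}
    (h : (blockHankel R k).rank = finitePolarDegree R) :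
    LinearMap.range (hankelColumns R k) = hankelSpace R := by
  have hle := range_hankelColumns_le R k
  have : FiniteDimensional ℂ (LinearMap.range (hankelColumns R k)) :=
    Submodule.finiteDimensional_of_le hle
  refine Submodule.eq_of_le_of_finrank_le hle ?_
  rw [finrank_hankelSpace, ← h, rank_blockHankel]
  exact Submodule.finrank_map_le _ _

theorem truncation_injective_of_rank {R : Matrix (Fin m) (Fin m) (RatFunc ℂ)} {k : ℕ}
    (h : (blockHankel R k).rank = finitePolarDegree R) :
    Function.Injective ((truncation m k).domRestrict (hankelSpace R)) := by
  rw [← LinearMap.ker_eq_bot, ← Submodule.finrank_eq_zero (R := ℂ)]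
  have h1 := LinearMap.finrank_range_add_finrank_ker ((truncation m k).domRestrict (hankelSpace R))
  rw [LinearMap.range_domRestrict, ← range_hankelColumns_of_rank h, ← rank_blockHankel, h,
    range_hankelColumns_of_rank h, finrank_hankelSpace] at h1
  lia

end HankelSpace

section Realization

/-! ### The realization obtained from a compression of the block Hankel matrix -/

theorem IsUnitary.toCols₁_conjTranspose_mul {a r s : Type*} [Fintype a] [DecidableEq a]
    [Fintype r] [DecidableEq r] [Fintype s] [DecidableEq s] {U : Matrix a (r ⊕ s) ℂ}
    (hU : IsUnitary U) : U.toCols₁ᴴ * U.toCols₁ = 1 := by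
  ext i j
  have h := congrFun (congrFun hU.1 (Sum.inl i)) (Sum.inl j)
  simpa [Matrix.mul_apply, Matrix.one_apply] using h

theorem rank_eq_of_vecMul {r : ℕ} {n : Type*} [Fintype n] {M : Matrix (Fin r) n ℂ}
    (h : ∀ ℓ, ℓ ᵥ* M = 0 → ℓ = 0) : M.rank = r := by
  have hinj : Function.Injective M.vecMul := by
    intro x y hxy
    rw [← sub_eq_zero]
    apply h
    rw [Matrix.sub_vecMul]
    exact sub_eq_zero.2 hxy
  simpa using (Matrix.vecMul_injective_iff.1 hinj).rank_matrix

theorem rank_eq_of_mulVec {r : ℕ} {n : Type*} [Fintype n] {M : Matrix n (Fin r) ℂ}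
    (h : ∀ x, M *ᵥ x = 0 → x = 0) : M.rank = r := by
  rw [← Matrix.rank_transpose]
  exact rank_eq_of_vecMul fun x hx => h x (by rwa [Matrix.vecMul_transpose] at hx)

variable {m k r s : ℕ}

/-- The shift corresponds to multiplying the polynomial vector by `X`. -/
theorem hankelSpace_shift {R : Matrix (Fin m) (Fin m) (RatFunc ℂ)} {x : ℕ → Fin m → ℂ}
    (hx : x ∈ hankelSpace R) : (fun i => x (i + 1)) ∈ hankelSpace R := by
  obtain ⟨u, rfl⟩ := hx
  refine ⟨fun b => Polynomial.X * u b, ?_⟩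
  ext i a
  have h : (R *ᵥ fun b => algebraMap ℂ[X] (RatFunc ℂ) (Polynomial.X * u b)) a =
      algebraMap ℂ[X] (RatFunc ℂ) Polynomial.X *
        (R *ᵥ fun b => algebraMap ℂ[X] (RatFunc ℂ) (u b)) a := by
    simp only [Matrix.mulVec, dotProduct, Finset.mul_sum]
    refine Finset.sum_congr rfl fun b _ => ?_
    rw [map_mul]
    ring
  simp only [hankelOperator, LinearMap.coe_mk, AddHom.coe_mk]
  rw [h, laurentHom_X_mul_coeff]
  push_cast
  rfl

/-- The state matrix `(U₁ᴴ H_σ V₁) Ĥ⁻¹`. -/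
def stateMatrix (R : Matrix (Fin m) (Fin m) (RatFunc ℂ)) (k : ℕ)
    (U V : Matrix (Fin k × Fin m) (Fin r ⊕ Fin s) ℂ) : Matrix (Fin r) (Fin r) ℂ :=
  U.toCols₁ᴴ * shiftedBlockHankel R k * V.toCols₁ * (compressedHankel R k U V)⁻¹

/-- Coordinates of a sequence of vectors with respect to `U₁`. -/
def stateCoordinates (U : Matrix (Fin k × Fin m) (Fin r ⊕ Fin s) ℂ) (x : ℕ → Fin m → ℂ) :
    Fin r → ℂ :=
  U.toCols₁ᴴ *ᵥ truncation m k x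

namespace IsHankelCompression

variable {R : Matrix (Fin m) (Fin m) (RatFunc ℂ)}
  {U V : Matrix (Fin k × Fin m) (Fin r ⊕ Fin s) ℂ}

theorem mul_inv (hc : IsHankelCompression R k U V) :
    compressedHankel R k U V * (compressedHankel R k U V)⁻¹ = 1 :=
  Matrix.mul_nonsing_inv _ ((Matrix.isUnit_iff_isUnit_det _).1 hc.invertible)

theorem inv_mul (hc : IsHankelCompression R k U V) :
    (compressedHankel R k U V)⁻¹ * compressedHankel R k U V = 1 :=
  Matrix.nonsing_inv_mul _ ((Matrix.isUnit_iff_isUnit_det _).1 hc.invertible)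

theorem stateMatrix_mul (hc : IsHankelCompression R k U V) :
    stateMatrix R k U V * compressedHankel R k U V =
      U.toCols₁ᴴ * shiftedBlockHankel R k * V.toCols₁ := by
  rw [stateMatrix, Matrix.mul_assoc, hc.inv_mul, Matrix.mul_one]

theorem blockHankel_eq (hc : IsHankelCompression R k U V) :
    blockHankel R k = U.toCols₁ * compressedHankel R k U V * V.toCols₁ᴴ := by
  have h : blockHankel R k = U * (Uᴴ * blockHankel R k * V) * Vᴴ := by
    rw [← Matrix.mul_assoc, ← Matrix.mul_assoc, hc.unitary_left.2, Matrix.one_mul,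
      Matrix.mul_assoc, hc.unitary_right.2, Matrix.mul_one]
  rw [h, hc.compress]
  conv_lhs => rw [← Matrix.fromCols_toCols U, ← Matrix.fromCols_toCols V]
  rw [Matrix.conjTranspose_fromCols_eq_fromRows_conjTranspose, Matrix.fromCols_mul_fromBlocks,
    Matrix.fromCols_mul_fromRows]
  simp

theorem stateCoordinates_hankelColumns (hc : IsHankelCompression R k U V)
    (y : Fin k × Fin m → ℂ) : stateCoordinates U (hankelColumns R k y) =
      (compressedHankel R k U V * V.toCols₁ᴴ) *ᵥ y := by
  rw [stateCoordinates, ← blockHankel_mulVec, Matrix.mulVec_mulVec, hc.blockHankel_eq,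
    ← Matrix.mul_assoc, ← Matrix.mul_assoc, hc.unitary_left.toCols₁_conjTranspose_mul,
    Matrix.one_mul]

theorem exists_stateCoordinates_eq (hc : IsHankelCompression R k U V) (v : Fin r → ℂ) :
    ∃ x ∈ hankelSpace R, stateCoordinates U x = v := by
  refine ⟨hankelColumns R k ((V.toCols₁ * (compressedHankel R k U V)⁻¹) *ᵥ v),
    range_hankelColumns_le R k ⟨_, rfl⟩, ?_⟩
  rw [hc.stateCoordinates_hankelColumns, Matrix.mulVec_mulVec, Matrix.mul_assoc,
    ← Matrix.mul_assoc V.toCols₁ᴴ, hc.unitary_right.toCols₁_conjTranspose_mul, Matrix.one_mul,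
    hc.mul_inv, Matrix.one_mulVec]

/-- All truncations lie in the column space of `H`, which is spanned by the orthonormal columns of
`U₁`. -/
theorem truncation_eq (hc : IsHankelCompression R k U V)
    (hk : (blockHankel R k).rank = finitePolarDegree R)
    {x : ℕ → Fin m → ℂ} (hx : x ∈ hankelSpace R) :
    truncation m k x = U.toCols₁ *ᵥ stateCoordinates U x := by
  rw [← range_hankelColumns_of_rank hk] at hx
  obtain ⟨y, rfl⟩ := hx
  rw [hc.stateCoordinates_hankelColumns, ← blockHankel_mulVec, Matrix.mulVec_mulVec,
    hc.blockHankel_eq, Matrix.mul_assoc]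

theorem stateCoordinates_shift (hc : IsHankelCompression R k U V)
    (hk : (blockHankel R k).rank = finitePolarDegree R)
    {x : ℕ → Fin m → ℂ} (hx : x ∈ hankelSpace R) :
    stateCoordinates U (fun i => x (i + 1)) = stateMatrix R k U V *ᵥ stateCoordinates U x := by
  rw [← range_hankelColumns_of_rank hk] at hx
  obtain ⟨y, rfl⟩ := hx
  -- The vector `y - V₁ V₁ᴴ y` is killed by `H`. Injectivity of truncation makes its whole infinite
  -- image zero, so `H_σ` kills it too and `y` may be replaced by `V₁ V₁ᴴ y`.
  have hker : hankelColumns R k (y - (V.toCols₁ * V.toCols₁ᴴ) *ᵥ y) = 0 := by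
    have h0 : truncation m k (hankelColumns R k (y - (V.toCols₁ * V.toCols₁ᴴ) *ᵥ y)) = 0 := by
      rw [← blockHankel_mulVec, Matrix.mulVec_sub, sub_eq_zero, Matrix.mulVec_mulVec,
        hc.blockHankel_eq, Matrix.mul_assoc _ V.toCols₁ᴴ, ← Matrix.mul_assoc V.toCols₁ᴴ,
        hc.unitary_right.toCols₁_conjTranspose_mul, Matrix.one_mul]
    have hmem := range_hankelColumns_le R k ⟨y - (V.toCols₁ * V.toCols₁ᴴ) *ᵥ y, rfl⟩
    have := truncation_injective_of_rank hk (a₁ := ⟨_, hmem⟩) (a₂ := 0)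
      (by rw [map_zero]; exact h0)
    exact congrArg Subtype.val this
  have hs : shiftedBlockHankel R k *ᵥ y =
      shiftedBlockHankel R k *ᵥ ((V.toCols₁ * V.toCols₁ᴴ) *ᵥ y) := by
    rw [← sub_eq_zero, ← Matrix.mulVec_sub, shiftedBlockHankel_mulVec, hker]
    rfl
  rw [hc.stateCoordinates_hankelColumns, stateCoordinates, ← shiftedBlockHankel_mulVec, hs,
    Matrix.mulVec_mulVec, Matrix.mulVec_mulVec, Matrix.mulVec_mulVec, ← Matrix.mul_assoc,
    ← Matrix.mul_assoc (stateMatrix R k U V), hc.stateMatrix_mul]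

theorem stateCoordinates_shift_iterate (hc : IsHankelCompression R k U V)
    (hk : (blockHankel R k).rank = finitePolarDegree R)
    {x : ℕ → Fin m → ℂ} (hx : x ∈ hankelSpace R) (j : ℕ) :
    (fun i => x (i + j)) ∈ hankelSpace R ∧
    stateCoordinates U (fun i => x (i + j)) =
      (stateMatrix R k U V) ^ j *ᵥ stateCoordinates U x := by
  induction j with
  | zero => simpa using hx
  | succ j ih =>
    have h : (fun i => x (i + (j + 1))) = fun i => (fun i => x (i + j)) (i + 1) := by
      ext i; ring_nf
    rw [h]
    refine ⟨hankelSpace_shift ih.1, ?_⟩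
    rw [hc.stateCoordinates_shift hk ih.1, ih.2, Matrix.mulVec_mulVec, pow_succ']

/-- Block `i` is the leading block of the `i`-fold shift. -/
theorem apply_eq [NeZero k] (hc : IsHankelCompression R k U V)
    (hk : (blockHankel R k).rank = finitePolarDegree R)
    {x : ℕ → Fin m → ℂ} (hx : x ∈ hankelSpace R) (i : ℕ) :
    x i = (firstBlock U * (stateMatrix R k U V) ^ i) *ᵥ stateCoordinates U x := by
  obtain ⟨h1, h2⟩ := hc.stateCoordinates_shift_iterate hk hx i
  rw [← Matrix.mulVec_mulVec, ← h2]
  ext a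
  have h := congrFun (hc.truncation_eq hk h1) (0, a)
  refine Eq.trans ?_ h
  simp [truncation]

/-- By the Hankel structure, block column `j` is the `j`-fold shift of block column `0`. -/
theorem mulVec_single [NeZero k] (hc : IsHankelCompression R k U V)
    (hk : (blockHankel R k).rank = finitePolarDegree R) (j : Fin k) (b : Fin m) :
    (compressedHankel R k U V * V.toCols₁ᴴ) *ᵥ Pi.single (j, b) 1 =
      ((stateMatrix R k U V) ^ (j : ℕ) * (compressedHankel R k U V * (firstBlock V)ᴴ)) *ᵥ
        Pi.single b 1 := by
  have h0 : (compressedHankel R k U V * (firstBlock V)ᴴ) *ᵥ Pi.single b 1 =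
      stateCoordinates U (hankelColumns R k (Pi.single (0, b) 1)) := by
    rw [hc.stateCoordinates_hankelColumns]
    ext p
    simp [Matrix.mul_apply, firstBlock]
  rw [← hc.stateCoordinates_hankelColumns, ← Matrix.mulVec_mulVec, h0,
    ← (hc.stateCoordinates_shift_iterate hk (range_hankelColumns_le R k ⟨_, rfl⟩) j).2]
  congr 1
  ext i a
  simp [hankelColumns_apply, Pi.single_apply]

/-- The Markov parameters of the realization. -/
theorem laurentCoeff_eq [NeZero k] (hc : IsHankelCompression R k U V)
    (hk : (blockHankel R k).rank = finitePolarDegree R) (i : ℕ) :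
    laurentCoeff R (i + 1) = firstBlock U * (stateMatrix R k U V) ^ i *
      (compressedHankel R k U V * (firstBlock V)ᴴ) := by
  ext a b
  have h := congrFun (hc.apply_eq hk (x := hankelColumns R k (Pi.single (0, b) 1))
    (range_hankelColumns_le R k ⟨_, rfl⟩) i) a
  rw [hc.stateCoordinates_hankelColumns, hc.mulVec_single hk, Matrix.mulVec_mulVec] at h
  simpa [hankelColumns_apply, Pi.single_apply] using h

/-- The blocks with `j < k` already form `Ĥ V₁ᴴ`, which has the right inverse `V₁ Ĥ⁻¹`. -/
theorem controllable [NeZero k] (hc : IsHankelCompression R k U V)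
    (hk : (blockHankel R k).rank = finitePolarDegree R) {ℓ : Fin r → ℂ}
    (h : ∀ j, ℓ ᵥ* ((stateMatrix R k U V) ^ j * (compressedHankel R k U V * (firstBlock V)ᴴ)) = 0) :
    ℓ = 0 := by
  have h0 : ℓ ᵥ* (compressedHankel R k U V * V.toCols₁ᴴ) = 0 := by
    ext ⟨j, b⟩
    have h1 := congrArg (fun v => ℓ ⬝ᵥ v) (hc.mulVec_single hk j b)
    simp only [Matrix.dotProduct_mulVec, h, dotProduct_single_one] at h1
    exact h1
  have h2 := congrArg (fun v => v ᵥ* (V.toCols₁ * (compressedHankel R k U V)⁻¹)) h0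
  simp only [Matrix.vecMul_vecMul, Matrix.zero_vecMul] at h2
  rwa [Matrix.mul_assoc, ← Matrix.mul_assoc V.toCols₁ᴴ,
    hc.unitary_right.toCols₁_conjTranspose_mul, Matrix.one_mul, hc.mul_inv,
    Matrix.vecMul_one] at h2

/-- Every `y` is the coordinate vector of a sequence in the Hankel space, and the hypothesis says
that all blocks of that sequence vanish. -/
theorem observable [NeZero k] (hc : IsHankelCompression R k U V)
    (hk : (blockHankel R k).rank = finitePolarDegree R) {y : Fin r → ℂ}
    (h : ∀ i, (firstBlock U * (stateMatrix R k U V) ^ i) *ᵥ y = 0) : y = 0 := by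
  obtain ⟨x, hx, rfl⟩ := hc.exists_stateCoordinates_eq y
  have hx0 : x = 0 := by
    ext1 i
    rw [hc.apply_eq hk hx, h]
    rfl
  rw [hx0, stateCoordinates, map_zero, Matrix.mulVec_zero]

end IsHankelCompression

end Realization

section StrongMinimality

/-! ### Strong minimality -/

theorem polyLaurent_pencil_mul_coeff (a b : ℂ) (x : LaurentSeries ℂ) (n : ℤ) :
    (polyLaurent (Polynomial.C a - Polynomial.X * Polynomial.C b) * x).coeff n =
      a * x.coeff n - b * x.coeff (n + 1) := by
  rw [map_sub, map_mul, polyLaurent_C, polyLaurent_C, polyLaurent_X, sub_mul, HahnSeries.coeff_sub,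
    mul_assoc, HahnSeries.coeff_single_mul, HahnSeries.C_mul_eq_smul, HahnSeries.C_mul_eq_smul]
  simp

theorem polyToRat_map_laurentHom {a b : Type*} (P : Matrix a b ℂ[X]) :
    (polyToRat P).map laurentHom = P.map polyLaurent := by
  ext i j
  simp [polyToRat, laurentHom_algebraMap]

variable {m k r s : ℕ}

/-- The pencil is minus the characteristic matrix of `F` times `H`, and the characteristic
polynomial is monic. -/
theorem det_pencil_ne_zero {F H : Matrix (Fin r) (Fin r) ℂ} (hH : IsUnit H) :
    (constPoly (F * H) - (Polynomial.X : ℂ[X]) • constPoly H).det ≠ 0 := by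
  have h : constPoly (F * H) - (Polynomial.X : ℂ[X]) • constPoly H =
      -(F.charmatrix * constPoly H) := by
    rw [Matrix.charmatrix, sub_mul, neg_sub, constPoly, constPoly, Matrix.map_mul,
      Matrix.scalar_apply, ← Matrix.smul_eq_diagonal_mul]
    rfl
  have hd : (constPoly H).det = Polynomial.C H.det := by
    rw [constPoly, RingHom.map_det]
    rfl
  rw [h, Matrix.det_neg, Matrix.det_mul, hd]
  refine mul_ne_zero (by simp) (mul_ne_zero F.charpoly_monic.ne_zero ?_)
  rw [Ne, Polynomial.C_eq_zero]
  exact ((Matrix.isUnit_iff_isUnit_det _).1 hH).ne_zero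

/-- The strictly proper Laurent series with given matrix coefficients. -/
def laurentMatrix {a b : Type*} (G : ℕ → Matrix a b ℂ) : Matrix a b (LaurentSeries ℂ) :=
  Matrix.of fun i j => HahnSeries.ofSuppBddBelow
    (fun n : ℤ => if 1 ≤ n then G (n - 1).toNat i j else 0)
    ⟨1, fun n hn => by
      by_contra h
      exact hn (if_neg h)⟩

theorem laurentMatrix_coeff {a b : Type*} (G : ℕ → Matrix a b ℂ) (i : a) (j : b) (n : ℤ) :
    (laurentMatrix G i j).coeff n = if 1 ≤ n then G (n - 1).toNat i j else 0 := rfl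

/-- The transfer function of a state space realization with given Markov parameters. -/
theorem transfer_eq {R : Matrix (Fin m) (Fin m) (RatFunc ℂ)} (hR : IsStrictlyProper R)
    {F H : Matrix (Fin r) (Fin r) ℂ} (hH : IsUnit H) {K : Matrix (Fin m) (Fin r) ℂ}
    {B : Matrix (Fin r) (Fin m) ℂ} (h : ∀ i, laurentCoeff R (i + 1) = K * F ^ i * B) :
    polyToRat (constPoly (K * H)) *
      (polyToRat (constPoly (F * H) - (Polynomial.X : ℂ[X]) • constPoly H))⁻¹ *
      polyToRat (-constPoly B) = R := by
  set Z := polyToRat (constPoly (F * H) - (Polynomial.X : ℂ[X]) • constPoly H) with hZ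
  have hHinv : H * H⁻¹ = 1 := Matrix.mul_nonsing_inv _ ((Matrix.isUnit_iff_isUnit_det _).1 hH)
  have hdet : Z.det ≠ 0 := by
    have : Z.det = algebraMap ℂ[X] (RatFunc ℂ)
        (constPoly (F * H) - (Polynomial.X : ℂ[X]) • constPoly H).det := by
      rw [hZ, polyToRat, RingHom.map_det]; rfl
    rw [this]
    exact RatFunc.algebraMap_ne_zero (det_pencil_ne_zero hH)
  set W := Z⁻¹ * polyToRat (-constPoly B) with hW
  have hZW : Z * W = polyToRat (-constPoly B) := by
    rw [hW, ← Matrix.mul_assoc, Matrix.mul_nonsing_inv _ (IsUnit.mk0 _ hdet), Matrix.one_mul]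
  have hdet' : IsUnit (Z.map laurentHom).det := by
    have : (Z.map laurentHom).det = laurentHom Z.det := by rw [RingHom.map_det]; rfl
    rw [this]
    exact IsUnit.mk0 _ ((map_ne_zero _).2 hdet)
  -- The series with coefficients `H⁻¹ Fⁱ B` at `λ^{-(i+1)}` is a candidate for `Z⁻¹ (-B)`: in the
  -- product the terms cancel in pairs, and only `-B` at index `0` survives.
  have hG : Z.map laurentHom * laurentMatrix (fun i => H⁻¹ * F ^ i * B) =
      (polyToRat (-constPoly B)).map laurentHom := by
    rw [hZ, polyToRat_map_laurentHom, polyToRat_map_laurentHom]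
    ext p b n
    rw [Matrix.mul_apply, HahnSeries.coeff_sum]
    have hterm (q : Fin r) : (((constPoly (F * H) - (Polynomial.X : ℂ[X]) • constPoly H).map
        polyLaurent) p q * laurentMatrix (fun i => H⁻¹ * F ^ i * B) q b).coeff n =
        (F * H) p q * (laurentMatrix (fun i => H⁻¹ * F ^ i * B) q b).coeff n -
          H p q * (laurentMatrix (fun i => H⁻¹ * F ^ i * B) q b).coeff (n + 1) :=
      polyLaurent_pencil_mul_coeff _ _ _ _
    simp only [hterm, laurentMatrix_coeff, Finset.sum_sub_distrib]
    have e1 (i : ℕ) : ∑ q, (F * H) p q * (H⁻¹ * F ^ i * B) q b = (F ^ (i + 1) * B) p b := by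
      rw [← Matrix.mul_apply]
      rw [pow_succ']
      simp only [Matrix.mul_assoc]
      rw [← Matrix.mul_assoc H, hHinv, Matrix.one_mul]
    have e2 (i : ℕ) : ∑ q, H p q * (H⁻¹ * F ^ i * B) q b = (F ^ i * B) p b := by
      rw [← Matrix.mul_apply]
      simp only [Matrix.mul_assoc]
      rw [← Matrix.mul_assoc H, hHinv, Matrix.one_mul]
    have hrhs : ((-constPoly B).map polyLaurent) p b = HahnSeries.C (-B p b) := by
      simp [constPoly, polyLaurent_C]
    rw [hrhs]
    rcases lt_trichotomy n 0 with hn | rfl | hn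
    · have h1 : ¬ (1 ≤ n) := by lia
      have h2 : ¬ (1 ≤ n + 1) := by lia
      simp [h1, h2, HahnSeries.C_apply, HahnSeries.coeff_single_of_ne hn.ne]
    · have := e2 0
      simp only [pow_zero, Matrix.mul_one, Matrix.one_mul] at this
      simp [this, HahnSeries.C_apply]
    · obtain ⟨i, rfl⟩ : ∃ i : ℕ, n = i + 1 := ⟨(n - 1).toNat, by lia⟩
      have h1 : (1 : ℤ) ≤ (i : ℤ) + 1 := by lia
      have h2 : (1 : ℤ) ≤ (i : ℤ) + 1 + 1 := by lia
      have h3 : ((i : ℤ) + 1 + 1 - 1).toNat = i + 1 := by lia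
      have h4 : ((i : ℤ) + 1 - 1).toNat = i := by lia
      simp only [h1, h2, h3, h4, if_true, e1, e2, sub_self, HahnSeries.C_apply]
      rw [HahnSeries.coeff_single_of_ne hn.ne']
  have hWG : W.map laurentHom = laurentMatrix (fun i => H⁻¹ * F ^ i * B) := by
    have h1 : Z.map laurentHom * W.map laurentHom =
        Z.map laurentHom * laurentMatrix (fun i => H⁻¹ * F ^ i * B) := by
      rw [hG, ← Matrix.map_mul, hZW]
    have h2 := congrArg (fun M => (Z.map laurentHom)⁻¹ * M) h1
    simpa only [← Matrix.mul_assoc, Matrix.nonsing_inv_mul _ hdet', Matrix.one_mul] using h2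
  rw [Matrix.mul_assoc, ← hW]
  -- The two sides are compared through their expansions; strict properness of `R` settles the
  -- indices `n ≤ 0`.
  apply Matrix.map_injective laurentHom.injective
  change (polyToRat (constPoly (K * H)) * W).map laurentHom = R.map laurentHom
  rw [Matrix.map_mul, hWG, polyToRat_map_laurentHom]
  ext a b n
  have e3 (i : ℕ) : ∑ q, (K * H) a q * (H⁻¹ * F ^ i * B) q b = laurentCoeff R (i + 1) a b := by
    rw [← Matrix.mul_apply, h]
    simp only [Matrix.mul_assoc]
    rw [← Matrix.mul_assoc H, hHinv, Matrix.one_mul]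
  have hterm (q : Fin r) : ((constPoly (K * H)).map polyLaurent) a q =
      HahnSeries.C ((K * H) a q) := polyLaurent_C _
  rw [Matrix.mul_apply, HahnSeries.coeff_sum, Matrix.map_apply]
  simp only [hterm, HahnSeries.C_mul_eq_smul, HahnSeries.coeff_smul, laurentMatrix_coeff,
    smul_eq_mul]
  by_cases hn : 1 ≤ n
  · obtain ⟨i, rfl⟩ : ∃ i : ℕ, n = i + 1 := ⟨(n - 1).toNat, by lia⟩
    have h4 : ((i : ℤ) + 1 - 1).toNat = i := by lia
    simp only [hn, if_true, h4, e3, laurentCoeff, Matrix.map_apply, laurentHom_apply]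
    push_cast
    rfl
  · simp only [hn, if_false, mul_zero, Finset.sum_const_zero]
    exact (laurentHom_coeff_of_nonpos (hR a b) (by lia)).symm

/-- The finite rank conditions follow by the Hautus test: a left null vector at `z` is a left
eigenvector of `F` killed by `B`, hence by every `Fʲ B`, contradicting controllability unless it is
zero; columns are dual, through observability. At infinity the coefficient of `λ` in the state block
is `-Ĥ`, which is invertible. -/
theorem IsHankelCompression.isStronglyMinimalLinearization [NeZero k]
    {R : Matrix (Fin m) (Fin m) (RatFunc ℂ)} (hR : IsStrictlyProper R)
    {U V : Matrix (Fin k × Fin m) (Fin r ⊕ Fin s) ℂ} (hc : IsHankelCompression R k U V)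
    (hk : (blockHankel R k).rank = finitePolarDegree R) :
    IsStronglyMinimalLinearization
      (systemPencil (U.toCols₁ᴴ * shiftedBlockHankel R k * V.toCols₁) (compressedHankel R k U V)
        (compressedHankel R k U V * (firstBlock V)ᴴ) (firstBlock U * compressedHankel R k U V))
      R := by
  rw [← hc.stateMatrix_mul]
  have hcon {ℓ : Fin r → ℂ} := hc.controllable hk (ℓ := ℓ)
  have hobs {y : Fin r → ℂ} := hc.observable hk (y := y)
  have hmark := hc.laurentCoeff_eq hk
  have hH := hc.invertible
  have hinv := hc.inv_mul
  have hinv' := hc.mul_inv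
  set F := stateMatrix R k U V
  set H := compressedHankel R k U V
  set B := H * (firstBlock V)ᴴ
  set K := firstBlock U
  have hleft {ℓ : Fin r → ℂ} {M : Matrix (Fin r) (Fin r) ℂ} (h : ℓ ᵥ* (M * H) = 0) :
      ℓ ᵥ* M = 0 := by
    have := congrArg (fun v => v ᵥ* H⁻¹) h
    simpa [Matrix.vecMul_vecMul, Matrix.mul_assoc, hinv'] using this
  have hright {x : Fin r → ℂ} (h : H *ᵥ x = 0) : x = 0 := by
    have := congrArg (fun v => H⁻¹ *ᵥ v) h
    simpa [Matrix.mulVec_mulVec, hinv] using this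
  have e11 (z : ℂ) : evalPoly (constPoly (F * H) - (Polynomial.X : ℂ[X]) • constPoly H) z =
      (F - z • 1) * H := by
    rw [sub_mul, Matrix.smul_mul, Matrix.one_mul]
    ext i j
    simp [evalPoly, constPoly, -Matrix.map_mul]
    ring
  refine ⟨?_, ?_, ?_, ?_, ?_, ?_, ?_⟩
  · rintro (i | i) (j | j)
    · simp only [systemPencil, constPoly, Matrix.fromBlocks_apply₁₁, Matrix.sub_apply,
        Matrix.smul_apply, Matrix.map_apply, smul_eq_mul]
      compute_degree
    · simp [systemPencil, constPoly, -Matrix.map_mul]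
    · simp [systemPencil, constPoly, -Matrix.map_mul]
    · simp [systemPencil]
  · rw [systemPencil, Matrix.toBlocks_fromBlocks₁₁]
    exact det_pencil_ne_zero hH
  · intro z
    have he : evalPoly (systemPencil (F * H) H B (K * H)).toRows₁ z =
        Matrix.fromCols ((F - z • 1) * H) B := by
      rw [← e11]
      ext i (j | j) <;> simp [evalPoly, systemPencil, constPoly, -Matrix.map_mul]
    rw [he]
    refine rank_eq_of_vecMul fun ℓ hℓ => hcon fun j => ?_
    rw [Matrix.vecMul_fromCols] at hℓ
    have h1 : ℓ ᵥ* (F - z • 1) = 0 := hleft (funext fun i => congrFun hℓ (Sum.inl i))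
    have h2 : ℓ ᵥ* B = 0 := funext fun i => congrFun hℓ (Sum.inr i)
    have h3 : ℓ ᵥ* F = z • ℓ := by
      rw [Matrix.vecMul_sub, sub_eq_zero] at h1
      rw [h1, Matrix.vecMul_smul, Matrix.vecMul_one]
    have h4 : ℓ ᵥ* F ^ j = z ^ j • ℓ := by
      induction j with
      | zero => simp
      | succ j ih => rw [pow_succ, ← Matrix.vecMul_vecMul, ih, Matrix.smul_vecMul, h3, smul_smul,
          pow_succ]
    rw [← Matrix.vecMul_vecMul, h4, Matrix.smul_vecMul, h2, smul_zero]
  · intro z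
    have he : evalPoly (systemPencil (F * H) H B (K * H)).toCols₁ z =
        Matrix.fromRows ((F - z • 1) * H) (K * H) := by
      rw [← e11]
      ext (i | i) j <;> simp [evalPoly, systemPencil, constPoly, -Matrix.map_mul]
    rw [he]
    refine rank_eq_of_mulVec fun x hx => hright (hobs fun j => ?_)
    rw [Matrix.fromRows_mulVec] at hx
    have h1 : ((F - z • 1) * H) *ᵥ x = 0 := funext fun i => congrFun hx (Sum.inl i)
    have h2 : (K * H) *ᵥ x = 0 := funext fun i => congrFun hx (Sum.inr i)
    rw [← Matrix.mulVec_mulVec] at h1 h2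
    have h3 : F *ᵥ (H *ᵥ x) = z • (H *ᵥ x) := by
      rw [Matrix.sub_mulVec, sub_eq_zero] at h1
      rw [h1, Matrix.smul_mulVec, Matrix.one_mulVec]
    have h4 : F ^ j *ᵥ (H *ᵥ x) = z ^ j • (H *ᵥ x) := by
      induction j with
      | zero => simp
      | succ j ih => rw [pow_succ', ← Matrix.mulVec_mulVec, ih, Matrix.mulVec_smul, h3, smul_smul,
          pow_succ]
    rw [← Matrix.mulVec_mulVec, h4, Matrix.mulVec_smul, h2, smul_zero]
  · refine rank_eq_of_vecMul fun ℓ hℓ => ?_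
    -- Written as `-1 * H` so that `hleft` can cancel `H`.
    have he : leadingPart (systemPencil (F * H) H B (K * H)).toRows₁ =
        Matrix.fromCols (-1 * H) 0 := by
      ext i (j | j) <;> simp [leadingPart, systemPencil, constPoly, Polynomial.coeff_C,
        -Matrix.map_mul]
    rw [he, Matrix.vecMul_fromCols] at hℓ
    have h1 : ℓ ᵥ* (-1 : Matrix (Fin r) (Fin r) ℂ) = 0 :=
      hleft (funext fun i => congrFun hℓ (Sum.inl i))
    simpa [Matrix.vecMul_neg] using h1
  · refine rank_eq_of_mulVec fun x hx => hright ?_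
    have he : leadingPart (systemPencil (F * H) H B (K * H)).toCols₁ =
        Matrix.fromRows (-H) 0 := by
      ext (i | i) j <;> simp [leadingPart, systemPencil, constPoly, Polynomial.coeff_C,
        -Matrix.map_mul]
    rw [he, Matrix.fromRows_mulVec] at hx
    have h1 : (-H) *ᵥ x = 0 := funext fun i => congrFun hx (Sum.inl i)
    simpa [Matrix.neg_mulVec] using h1
  · rw [systemPencil, Matrix.toBlocks_fromBlocks₁₁, Matrix.toBlocks_fromBlocks₁₂,
      Matrix.toBlocks_fromBlocks₂₁, Matrix.toBlocks_fromBlocks₂₂, transfer_eq hR hH hmark]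
    simp [polyToRat]

end StrongMinimality

/-! ### Self-conjugate structures on Laurent coefficients -/

/-- The polynomial whose value at `w` is the conjugate of the value of `p` at the conjugate of
`ε w`. -/
def polyReflect (ε : ℂ) : ℂ[X] →+* ℂ[X] :=
  (Polynomial.compRingHom (Polynomial.C ε * Polynomial.X)).comp
    (Polynomial.mapRingHom (starRingEnd ℂ))

theorem polyReflect_eval (ε : ℂ) (p : ℂ[X]) (w : ℂ) :
    (polyReflect ε p).eval w = star (p.eval (star (ε * w))) := by
  have h : (ε * w) = starRingEnd ℂ (star (ε * w)) := by simp
  simp only [polyReflect, RingHom.comp_apply, Polynomial.coe_mapRingHom,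
    Polynomial.coe_compRingHom_apply, Polynomial.eval_comp, Polynomial.eval_mul,
    Polynomial.eval_C, Polynomial.eval_X]
  rw [h, Polynomial.eval_map_apply]
  simp

/-- The conjugation of Laurent series that multiplies the coefficient of index `i` by `ε ^ i`. -/
def laurentReflect {ε : ℂ} (hε : ε ≠ 0) : LaurentSeries ℂ →+* LaurentSeries ℂ where
  toFun x := ⟨fun i => ε ^ i * star (x.coeff i),
    x.isPWO_support.mono fun i hi h => hi (by simp [h])⟩
  map_one' := by
    ext i
    by_cases hi : i = 0 <;> simp [hi, HahnSeries.coeff_one]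
  map_zero' := by ext i; simp
  map_add' x y := by ext i; simp [mul_add]
  map_mul' x y := by
    ext i
    simp only [HahnSeries.coeff_mul, star_sum, Finset.mul_sum]
    refine Finset.sum_congr ?_ fun c hc => ?_
    · ext c
      simp [zpow_ne_zero _ hε]
    · rw [← (Finset.mem_antidiagonal.1 hc).2.2, zpow_add₀ hε, star_mul']
      ring

theorem laurentReflect_coeff {ε : ℂ} (hε : ε ≠ 0) (x : LaurentSeries ℂ) (i : ℤ) :
    (laurentReflect hε x).coeff i = ε ^ i * star (x.coeff i) := rfl

/-- Both composites are ring homomorphisms on `ℂ[X]`, so constants and `X` suffice. At `X` the two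
sides carry `ε⁻¹` and `ε`, which agree because `ε * ε = 1`. -/
theorem laurentReflect_polyLaurent {ε : ℂ} (hε : ε ≠ 0) (h : ε * ε = 1) (p : ℂ[X]) :
    laurentReflect hε (polyLaurent p) = polyLaurent (polyReflect ε p) := by
  have key : (laurentReflect hε).comp polyLaurent = polyLaurent.comp (polyReflect ε) := by
    apply Polynomial.ringHom_ext
    · intro a
      ext i
      by_cases hi : i = 0 <;>
        simp [laurentReflect_coeff, polyReflect, polyLaurent_C, HahnSeries.C_apply, hi]
    · ext i
      by_cases hi : i = -1 <;>
        simp [laurentReflect_coeff, polyReflect, polyLaurent_C, polyLaurent_X,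
          hi, inv_eq_of_mul_eq_one_left h]
  exact congrArg (fun f => f p) key

/-- The sign in the reflected point `± conj λ`. -/
def SelfConjugacy.reflectSign : SelfConjugacy → ℂ
  | hermitian => 1
  | skewHermitian => 1
  | paraHermitian => -1
  | paraSkewHermitian => -1

namespace SelfConjugacy

theorem reflect_eq (κ : SelfConjugacy) (z : ℂ) : κ.reflect z = κ.reflectSign * star z := by
  cases κ <;> simp [reflect, reflectSign]

theorem reflectSign_mul_self (κ : SelfConjugacy) : κ.reflectSign * κ.reflectSign = 1 := by
  cases κ <;> simp [reflectSign]

theorem sign_mul_self (κ : SelfConjugacy) : κ.sign * κ.sign = 1 := by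
  cases κ <;> simp [sign]

theorem star_reflectSign (κ : SelfConjugacy) : star κ.reflectSign = κ.reflectSign := by
  cases κ <;> simp [reflectSign]

theorem star_sign (κ : SelfConjugacy) : star κ.sign = κ.sign := by
  cases κ <;> simp [sign]

theorem reflectSign_ne_zero (κ : SelfConjugacy) : κ.reflectSign ≠ 0 :=
  left_ne_zero_of_mul_eq_one κ.reflectSign_mul_self

/-- Turns the pointwise symmetry into an identity of Laurent series: clear denominators, obtain an
identity of polynomials from their values, then expand at infinity. -/
theorem HoldsRat.laurentReflect_eq {κ : SelfConjugacy} {m : ℕ}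
    {R : Matrix (Fin m) (Fin m) (RatFunc ℂ)} (h : κ.HoldsRat R) (a b : Fin m) :
    laurentReflect κ.reflectSign_ne_zero (laurentHom (R b a)) =
      HahnSeries.C κ.sign * laurentHom (R a b) := by
  set θ := laurentReflect κ.reflectSign_ne_zero
  have hθ (p : ℂ[X]) : polyLaurent (polyReflect κ.reflectSign p) = θ (polyLaurent p) :=
    (laurentReflect_polyLaurent _ κ.reflectSign_mul_self p).symm
  set D : ℂ[X] := ∏ i, ∏ j, (R i j).denom with hD
  have hD0 : D ≠ 0 := Finset.prod_ne_zero_iff.2 fun i _ =>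
    Finset.prod_ne_zero_iff.2 fun j _ => (R i j).denom_ne_zero
  have hreg {z : ℂ} (hz : D.eval z ≠ 0) : IsRegularPoint R z := by
    intro i j hij
    apply hz
    rw [hD, Polynomial.eval_prod]
    refine Finset.prod_eq_zero (Finset.mem_univ i) ?_
    rw [Polynomial.eval_prod]
    exact Finset.prod_eq_zero (Finset.mem_univ j) hij
  -- The factor `D * polyReflect κ.reflectSign D` vanishes wherever `w` or its reflection may be a
  -- pole, so the product is zero at every `w`; the factor itself is nonzero and can be cancelled.
  have hprod : (polyReflect κ.reflectSign (R b a).num * (R a b).denom -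
      Polynomial.C κ.sign * (R a b).num * polyReflect κ.reflectSign (R b a).denom) *
      (D * polyReflect κ.reflectSign D) = 0 := by
    apply Polynomial.funext
    intro w
    simp only [Polynomial.eval_mul, Polynomial.eval_sub, polyReflect_eval, Polynomial.eval_C,
      Polynomial.eval_zero]
    set z := star (κ.reflectSign * w) with hz
    have hzw : κ.reflect z = w := by
      rw [reflect_eq, hz, star_star, ← mul_assoc, reflectSign_mul_self, one_mul]
    by_cases hw : D.eval w = 0
    · simp [hw]
    by_cases hz' : D.eval z = 0
    · simp [hz']
    have h1 := hreg hw
    have h2 := hreg hz'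
    have h3 := congrFun (congrFun (h z h2 (by rwa [hzw])) a) b
    rw [hzw] at h3
    simp only [evalRat, RatFunc.eval, Matrix.conjTranspose_apply, Matrix.map_apply,
      Matrix.smul_apply, smul_eq_mul, Polynomial.eval₂_id, star_div₀] at h3
    rw [← mul_div_assoc, div_eq_div_iff (star_ne_zero.2 (h2 b a)) (h1 a b)] at h3
    rw [h3, sub_self, zero_mul]
  have hcross : polyReflect κ.reflectSign (R b a).num * (R a b).denom =
      Polynomial.C κ.sign * (R a b).num * polyReflect κ.reflectSign (R b a).denom := by
    rw [← sub_eq_zero]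
    refine (mul_eq_zero.1 hprod).resolve_right (mul_ne_zero hD0 fun h0 => hD0 ?_)
    have h1 := congrArg polyLaurent h0
    rw [hθ, map_zero, map_eq_zero] at h1
    exact (map_eq_zero_iff _ polyLaurent_injective).1 h1
  have h1 := congrArg polyLaurent hcross
  simp only [map_mul, hθ, polyLaurent_C] at h1
  have hne (r : RatFunc ℂ) : polyLaurent r.denom ≠ 0 :=
    (map_ne_zero_iff _ polyLaurent_injective).2 r.denom_ne_zero
  have hdiv (r : RatFunc ℂ) : laurentHom r = polyLaurent r.num / polyLaurent r.denom := by
    nth_rewrite 1 [← r.num_div_denom]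
    rw [map_div₀, laurentHom_algebraMap, laurentHom_algebraMap]
  rw [hdiv, hdiv, map_div₀, ← mul_div_assoc,
    div_eq_div_iff ((map_ne_zero _).2 (hne _)) (hne _), h1]

theorem HoldsRat.laurentCoeff_conjTranspose {κ : SelfConjugacy} {m : ℕ}
    {R : Matrix (Fin m) (Fin m) (RatFunc ℂ)} (h : κ.HoldsRat R) (i : ℕ) :
    (laurentCoeff R i)ᴴ = (κ.sign * κ.reflectSign ^ i) • laurentCoeff R i := by
  ext a b
  have h1 := congrArg (fun x => κ.reflectSign ^ i * HahnSeries.coeff x (i : ℤ))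
    (h.laurentReflect_eq a b)
  simp only [laurentReflect_coeff, HahnSeries.C_mul_eq_smul, HahnSeries.coeff_smul, smul_eq_mul,
    zpow_natCast] at h1
  rw [← mul_assoc, ← mul_pow, reflectSign_mul_self, one_pow, one_mul] at h1
  simp only [laurentCoeff, Matrix.conjTranspose_apply, Matrix.map_apply, Matrix.smul_apply,
    smul_eq_mul, ← laurentHom_apply]
  rw [h1]
  ring

/-! ### Scaled Hankel matrices and structured pencils -/

/-- The block diagonal scaling attached to a self-conjugate structure: the identity or `S`. -/
def scalingMatrix (κ : SelfConjugacy) (k m : ℕ) : Matrix (Fin k × Fin m) (Fin k × Fin m) ℂ :=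
  Matrix.diagonal fun a => κ.reflectSign ^ (a.1.val + 1)

theorem scalingMatrix_conjTranspose (κ : SelfConjugacy) (k m : ℕ) :
    (κ.scalingMatrix k m)ᴴ = κ.scalingMatrix k m := by
  rw [scalingMatrix, Matrix.diagonal_conjTranspose]
  congr 1
  ext a
  simp only [Pi.star_apply, star_pow, star_reflectSign]

theorem pow_mul_pow_add (κ : SelfConjugacy) (i j l : ℕ) :
    κ.reflectSign ^ i * κ.reflectSign ^ (i + j + l) = κ.reflectSign ^ (j + l) := by
  rw [add_assoc, pow_add, ← mul_assoc, ← mul_pow, reflectSign_mul_self, one_pow, one_mul]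

/-- In block `(i, j)`, the transposed scaling `τ^(j+1)` times the coefficient sign `τ^(i+j+1)`
leaves `τ^i = τ * τ^(i+1)`, again a row scaling. For `H_σ` the extra `τ` disappears. -/
theorem HoldsRat.scaled_blockHankel_conjTranspose {κ : SelfConjugacy} {m : ℕ}
    {R : Matrix (Fin m) (Fin m) (RatFunc ℂ)} (h : κ.HoldsRat R) (k : ℕ) :
    (κ.scalingMatrix k m * blockHankel R k)ᴴ =
      (κ.sign * κ.reflectSign) • (κ.scalingMatrix k m * blockHankel R k) := by
  ext ⟨i, a⟩ ⟨j, b⟩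
  have hc := congrFun (congrFun (h.laurentCoeff_conjTranspose (j + i + 1)) a) b
  simp only [Matrix.conjTranspose_apply, Matrix.smul_apply, smul_eq_mul] at hc
  simp only [scalingMatrix, blockHankel, Matrix.conjTranspose_apply, Matrix.diagonal_mul,
    Matrix.of_apply, Matrix.smul_apply, smul_eq_mul, star_mul', star_pow, star_reflectSign, hc]
  have hp := κ.pow_mul_pow_add (j + 1) i 0
  rw [show (j : ℕ) + 1 + i + 0 = j + i + 1 by ring] at hp
  rw [add_comm (i : ℕ) j, show κ.sign * κ.reflectSign * (κ.reflectSign ^ ((i : ℕ) + 1) *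
    laurentCoeff R (j + i + 1) a b) = κ.sign * (κ.reflectSign * κ.reflectSign) *
      κ.reflectSign ^ (i : ℕ) * laurentCoeff R (j + i + 1) a b by ring, reflectSign_mul_self]
  simp only [add_zero] at hp
  linear_combination κ.sign * laurentCoeff R (j + i + 1) a b * hp

theorem HoldsRat.scaled_shiftedBlockHankel_conjTranspose {κ : SelfConjugacy} {m : ℕ}
    {R : Matrix (Fin m) (Fin m) (RatFunc ℂ)} (h : κ.HoldsRat R) (k : ℕ) :
    (κ.scalingMatrix k m * shiftedBlockHankel R k)ᴴ =
      κ.sign • (κ.scalingMatrix k m * shiftedBlockHankel R k) := by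
  ext ⟨i, a⟩ ⟨j, b⟩
  have hc := congrFun (congrFun (h.laurentCoeff_conjTranspose (j + i + 2)) a) b
  simp only [Matrix.conjTranspose_apply, Matrix.smul_apply, smul_eq_mul] at hc
  simp only [scalingMatrix, shiftedBlockHankel, Matrix.conjTranspose_apply, Matrix.diagonal_mul,
    Matrix.of_apply, Matrix.smul_apply, smul_eq_mul, star_mul', star_pow, star_reflectSign, hc]
  have hp := κ.pow_mul_pow_add (j + 1) i 1
  rw [show (j : ℕ) + 1 + i + 1 = j + i + 2 by ring] at hp
  rw [add_comm (i : ℕ) j]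
  linear_combination κ.sign * laurentCoeff R (j + i + 2) a b * hp

/-- The factor `κ.reflectSign` in the symmetry of `H` is what converts `star z` into the reflected
point in the term `z • H`. -/
theorem holdsPoly_systemPencil {κ : SelfConjugacy} {m r : ℕ} {M H : Matrix (Fin r) (Fin r) ℂ}
    {N : Matrix (Fin r) (Fin m) ℂ} {K : Matrix (Fin m) (Fin r) ℂ} (hM : Mᴴ = κ.sign • M)
    (hH : Hᴴ = (κ.sign * κ.reflectSign) • H) (hK : Kᴴ = κ.sign • N) :
    κ.HoldsPoly (systemPencil M H N K) := by
  have hN : Nᴴ = κ.sign • K := by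
    have h := congrArg (fun A => κ.sign • Aᴴ) hK
    simp only [Matrix.conjTranspose_conjTranspose, Matrix.conjTranspose_smul, star_sign, smul_smul,
      sign_mul_self, one_smul] at h
    exact h.symm
  have he (z : ℂ) : evalPoly (systemPencil M H N K) z = Matrix.fromBlocks (M - z • H) N K 0 := by
    ext (i | i) (j | j) <;> simp [evalPoly, systemPencil, constPoly]
    ring
  intro z
  rw [he, he, Matrix.fromBlocks_conjTranspose, Matrix.fromBlocks_smul, Matrix.conjTranspose_sub,
    Matrix.conjTranspose_smul, hM, hH, hN, hK, reflect_eq, smul_sub, smul_smul, smul_smul]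
  congr 2
  · congr 1
    ring
  · simp

theorem toCols₁_mul {a n r s : Type*} [Fintype a] (E : Matrix n a ℂ) (V : Matrix a (r ⊕ s) ℂ) :
    (E * V).toCols₁ = E * V.toCols₁ := rfl

/-- The structured linearization, for all four structures at once. -/
theorem HoldsRat.structured_linearization {κ : SelfConjugacy} {m k r s : ℕ} [NeZero k]
    {R : Matrix (Fin m) (Fin m) (RatFunc ℂ)} (hR : IsStrictlyProper R)
    (hk : (blockHankel R k).rank = finitePolarDegree R)
    {U V : Matrix (Fin k × Fin m) (Fin r ⊕ Fin s) ℂ} (hc : IsHankelCompression R k U V)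
    (h : κ.HoldsRat R) (hUV : U = κ.scalingMatrix k m * V) :
    (compressedHankel R k U V)ᴴ = (κ.sign * κ.reflectSign) • compressedHankel R k U V ∧
    (κ.scalingMatrix k m * shiftedBlockHankel R k)ᴴ =
      κ.sign • (κ.scalingMatrix k m * shiftedBlockHankel R k) ∧
    IsStronglyMinimalLinearization
      (systemPencil (V.toCols₁ᴴ * (κ.scalingMatrix k m * shiftedBlockHankel R k) * V.toCols₁)
        (compressedHankel R k U V) (compressedHankel R k U V * (firstBlock V)ᴴ)
        (κ.reflectSign • (firstBlock V * compressedHankel R k U V))) R ∧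
    κ.HoldsPoly
      (systemPencil (V.toCols₁ᴴ * (κ.scalingMatrix k m * shiftedBlockHankel R k) * V.toCols₁)
        (compressedHankel R k U V) (compressedHankel R k U V * (firstBlock V)ᴴ)
        (κ.reflectSign • (firstBlock V * compressedHankel R k U V))) := by
  have hU : U.toCols₁ᴴ = V.toCols₁ᴴ * κ.scalingMatrix k m := by
    rw [hUV, toCols₁_mul, Matrix.conjTranspose_mul, scalingMatrix_conjTranspose]
  -- Block index `0` has scaling exponent `1`; this produces the minus sign of the lower left block
  -- in the para cases.
  have hfirst : firstBlock U = κ.reflectSign • firstBlock V := by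
    ext a p
    simp [firstBlock, hUV, scalingMatrix, Matrix.diagonal_mul]
  have hcomp : compressedHankel R k U V =
      V.toCols₁ᴴ * (κ.scalingMatrix k m * blockHankel R k) * V.toCols₁ := by
    rw [compressedHankel, hU, Matrix.mul_assoc V.toCols₁ᴴ]
  have hsym {A : Matrix (Fin k × Fin m) (Fin k × Fin m) ℂ} {c : ℂ} (hA : Aᴴ = c • A) :
      (V.toCols₁ᴴ * A * V.toCols₁)ᴴ = c • (V.toCols₁ᴴ * A * V.toCols₁) := by
    rw [Matrix.conjTranspose_mul, Matrix.conjTranspose_mul, Matrix.conjTranspose_conjTranspose, hA,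
      Matrix.smul_mul, Matrix.mul_smul, Matrix.mul_assoc]
  have h1 : (compressedHankel R k U V)ᴴ =
      (κ.sign * κ.reflectSign) • compressedHankel R k U V := by
    rw [hcomp]
    exact hsym (h.scaled_blockHankel_conjTranspose k)
  have h2 := h.scaled_shiftedBlockHankel_conjTranspose k
  refine ⟨h1, h2, ?_, holdsPoly_systemPencil (hsym h2) h1 ?_⟩
  · have := hc.isStronglyMinimalLinearization hR hk
    rwa [hU, hfirst, Matrix.smul_mul, Matrix.mul_assoc V.toCols₁ᴴ] at this
  · rw [Matrix.conjTranspose_smul, Matrix.conjTranspose_mul, h1, star_reflectSign, Matrix.smul_mul,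
      smul_smul, mul_left_comm, reflectSign_mul_self, mul_one]

theorem scalingMatrix_of_reflectSign_eq_one {κ : SelfConjugacy} (h : κ.reflectSign = 1)
    (k m : ℕ) : κ.scalingMatrix k m = 1 := by
  simp [scalingMatrix, h]

theorem scalingMatrix_of_reflectSign_eq_neg_one {κ : SelfConjugacy} (h : κ.reflectSign = -1)
    (k m : ℕ) : κ.scalingMatrix k m = scaling k m := by
  rw [scalingMatrix, h, scaling]

end SelfConjugacy

end RationalLinearization

end

/-! ### Specialization to the four structures -/

open RationalLinearization in
theorem mainTheorem6 {m : ℕ} (R : Matrix (Fin m) (Fin m) (RatFunc ℂ)) (hR : IsStrictlyProper R) :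
    -- all sufficiently large `k` are admissible
    (∃ K : ℕ, ∀ k, K ≤ k → (blockHankel R k).rank = finitePolarDegree R) ∧
    -- the linearizations, for every admissible `k` and every compression
    ∀ (k : ℕ) [NeZero k], (blockHankel R k).rank = finitePolarDegree R →
    ∀ (r s : ℕ) (U V : Matrix (Fin k × Fin m) (Fin r ⊕ Fin s) ℂ), IsHankelCompression R k U V →
      (SelfConjugacy.hermitian.HoldsRat R → U = V →
        (compressedHankel R k U V)ᴴ = compressedHankel R k U V ∧
        (shiftedBlockHankel R k)ᴴ = shiftedBlockHankel R k ∧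
        IsStronglyMinimalLinearization
          (systemPencil (V.toCols₁ᴴ * shiftedBlockHankel R k * V.toCols₁) (compressedHankel R k U V)
            (compressedHankel R k U V * (firstBlock V)ᴴ) (firstBlock V * compressedHankel R k U V))
          R ∧
        SelfConjugacy.hermitian.HoldsPoly
          (systemPencil (V.toCols₁ᴴ * shiftedBlockHankel R k * V.toCols₁) (compressedHankel R k U V)
            (compressedHankel R k U V * (firstBlock V)ᴴ)
            (firstBlock V * compressedHankel R k U V))) ∧
      (SelfConjugacy.skewHermitian.HoldsRat R → U = V →
        (compressedHankel R k U V)ᴴ = -compressedHankel R k U V ∧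
        (shiftedBlockHankel R k)ᴴ = -shiftedBlockHankel R k ∧
        IsStronglyMinimalLinearization
          (systemPencil (V.toCols₁ᴴ * shiftedBlockHankel R k * V.toCols₁) (compressedHankel R k U V)
            (compressedHankel R k U V * (firstBlock V)ᴴ) (firstBlock V * compressedHankel R k U V))
          R ∧
        SelfConjugacy.skewHermitian.HoldsPoly
          (systemPencil (V.toCols₁ᴴ * shiftedBlockHankel R k * V.toCols₁) (compressedHankel R k U V)
            (compressedHankel R k U V * (firstBlock V)ᴴ)
            (firstBlock V * compressedHankel R k U V))) ∧
      (SelfConjugacy.paraHermitian.HoldsRat R → U = scaling k m * V →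
        (compressedHankel R k U V)ᴴ = -compressedHankel R k U V ∧
        (scaling k m * shiftedBlockHankel R k)ᴴ = scaling k m * shiftedBlockHankel R k ∧
        IsStronglyMinimalLinearization
          (systemPencil (V.toCols₁ᴴ * (scaling k m * shiftedBlockHankel R k) * V.toCols₁)
            (compressedHankel R k U V) (compressedHankel R k U V * (firstBlock V)ᴴ)
            (-(firstBlock V * compressedHankel R k U V)))
          R ∧
        SelfConjugacy.paraHermitian.HoldsPoly
          (systemPencil (V.toCols₁ᴴ * (scaling k m * shiftedBlockHankel R k) * V.toCols₁)
            (compressedHankel R k U V) (compressedHankel R k U V * (firstBlock V)ᴴ)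
            (-(firstBlock V * compressedHankel R k U V)))) ∧
      (SelfConjugacy.paraSkewHermitian.HoldsRat R → U = scaling k m * V →
        (compressedHankel R k U V)ᴴ = compressedHankel R k U V ∧
        (scaling k m * shiftedBlockHankel R k)ᴴ = -(scaling k m * shiftedBlockHankel R k) ∧
        IsStronglyMinimalLinearization
          (systemPencil (V.toCols₁ᴴ * (scaling k m * shiftedBlockHankel R k) * V.toCols₁)
            (compressedHankel R k U V) (compressedHankel R k U V * (firstBlock V)ᴴ)
            (-(firstBlock V * compressedHankel R k U V)))
          R ∧
        SelfConjugacy.paraSkewHermitian.HoldsPoly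
          (systemPencil (V.toCols₁ᴴ * (scaling k m * shiftedBlockHankel R k) * V.toCols₁)
            (compressedHankel R k U V) (compressedHankel R k U V * (firstBlock V)ᴴ)
            (-(firstBlock V * compressedHankel R k U V)))) := by
  refine ⟨exists_rank_blockHankel_eq R, fun k _ hk r s U V hc => ⟨?_, ?_, ?_, ?_⟩⟩
  · intro h hUV
    have he := SelfConjugacy.scalingMatrix_of_reflectSign_eq_one
      (κ := SelfConjugacy.hermitian) rfl k m
    have := h.structured_linearization hR hk hc (by rw [he, Matrix.one_mul, hUV])
    simpa only [he, SelfConjugacy.sign, SelfConjugacy.reflectSign, one_mul, mul_one, one_smul,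
      Matrix.one_mul] using this
  · intro h hUV
    have he := SelfConjugacy.scalingMatrix_of_reflectSign_eq_one
      (κ := SelfConjugacy.skewHermitian) rfl k m
    have := h.structured_linearization hR hk hc (by rw [he, Matrix.one_mul, hUV])
    simpa only [he, SelfConjugacy.sign, SelfConjugacy.reflectSign, mul_one, one_smul, neg_smul,
      Matrix.one_mul] using this
  · intro h hUV
    have he := SelfConjugacy.scalingMatrix_of_reflectSign_eq_neg_one
      (κ := SelfConjugacy.paraHermitian) rfl k m
    have := h.structured_linearization hR hk hc (by rw [he, hUV])
    simpa only [he, SelfConjugacy.sign, SelfConjugacy.reflectSign, one_mul, one_smul, neg_smul]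
      using this
  · intro h hUV
    have he := SelfConjugacy.scalingMatrix_of_reflectSign_eq_neg_one
      (κ := SelfConjugacy.paraSkewHermitian) rfl k m
    have := h.structured_linearization hR hk hc (by rw [he, hUV])
    simpa only [he, SelfConjugacy.sign, SelfConjugacy.reflectSign, neg_mul_neg, one_mul, mul_one,
      one_smul, neg_smul] using this
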